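/- Consider an open multiclass queueing network with stations $j=1,\dots,J$ and classes $k=1,\dots,K$. Class $k$ is served at station $s(k)$ with mean service time $m_k>0$, has exogenous arrival rate $\alpha_k\ge 0$, and routing is given by a nonnegative substochastic matrix $P$ such that $\sum_n P^n$ converges. Let $M=\mathrm{diag}(m_1,\dots,m_K)$, $C_{jk}=1$ if $s(k)=j$ and $C_{jk}=0$ otherwise, and $\mathcal C(j)=\{k:s(k)=j\}$. A ratio matrix is a nonnegative $K\times J$ matrix $\Delta$ with $\Delta_{kj}=0$ for $s(k)\ne j$ and $CM\Delta=I$. It is static-priority if in each column $j$ its only nonzero entry is $\Delta_{kj}=1/m_k$ for a single class $k\in\mathcal C(j)$ (the lowest-priority class of station $j$); $\mathcal H^\Delta$ denotes the set of all other (high-priority) classes. A queue-ratio policy is given by a ratio matrix $\Delta$ and a tie-breaking order, i.e. a permutation $\pi$ of the classes; write $i\preceq k$ if $s(i)=s(k)$ and $\pi(i)\le\pi(k)$. A solution of its fluid model consists of functions $(\bar Z,\bar W,\bar\epsilon,\bar T,\bar Y)$ on $[0,\infty)$ with $\bar Z\ge 0$ and $$\bar Z(t)=\bar Z(0)+\alpha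 t-(I-P')M^{-1}\bar T(t),\quad \bar W=CM\bar Z,\quad \bar\epsilon=\bar Z-\Delta CM\bar Z,$$ $$\bar T(0)=0,\ \bar T \text{ nondecreasing},\qquad \bar Y(t)=et-C\bar T(t) \text{ nondecreasing},$$ $$\int_0^t \bar W_j(s)\,d\bar Y_j(s)=0 \quad (t\ge 0,\ j=1,\dots,J),$$ $$\int_0^t \Big(\sum_{i\preceq k,\ \bar\epsilon_i(s)>0}\bar\epsilon_i(s)\Big)\Big(1-\sum_{i\preceq k,\ \bar\epsilon_i(s)\ge 0}\dot{\bar T}_i(s)\Big)ds=0 \quad (t\ge 0,\ k=1,\dots,K).$$ (The functions $\bar T,\bar Y$ are automatically Lipschitz.) A time $t>0$ is regular if $\bar T$ is differentiable at $t$. Given $h\in\mathbb R^K$ with all $h_k>0$ and $\hbar>0$, linear attraction with $h$ and $\hbar$ holds for a static-priority $\Delta$ if, for every tie-breaking order $\pi$ and every fluid solution of the policy $(\Delta,\pi)$, $$\sum_{k\in\mathcal H^\Delta:\ \bar Z_k(t)>0}h_k\,\dot{\bar Z}_k(t)\le-\hbar\quad\text{at every regular time } t \text{ with } \|\bar Z_{\mathcal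 H^\Delta}(t)\|>0 .$$ Theorem. Suppose that there are $h\in\mathbb R^K$ with all $h_k>0$ and $\hbar>0$ such that linear attraction with $h$ and $\hbar$ holds for every static-priority $\Delta$. Then for every ratio matrix $\Delta$, every tie-breaking order $\pi$ and every initial state $z_0\in\mathbb R^K_{\ge 0}$ there is $t_0\ge 0$ such that every fluid solution of the policy $(\Delta,\pi)$ with $\bar Z(0)=z_0$ satisfies $\bar\epsilon(t)=\bar Z(t)-\Delta CM\bar Z(t)=0$ for all $t\ge t_0$. -/

import Mathlib

open scoped Matrix

noncomputable section

/-- Primitives `(C, M, P, α)` of an open multiclass queueing network with `J` stations and `K`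
classes. Class `k` is served at station `station k`, has mean service time `m k`, exogenous arrival
rate `α k`, and turns into class `l` with probability `P k l` when its service is completed. -/
structure QueueingNetwork (J K : ℕ) where
  station : Fin K → Fin J
  m : Fin K → ℝ
  m_pos : ∀ k, 0 < m k
  P : Matrix (Fin K) (Fin K) ℝ
  P_nonneg : ∀ k l, 0 ≤ P k l
  P_row_sum_le : ∀ k, ∑ l, P k l ≤ 1
  /-- The network is open: `I + P + P² + ⋯` converges (so `I - Pᵀ` is invertible). -/
  P_open : Summable fun n : ℕ => P ^ n
  α : Fin K → ℝ
  α_nonneg : ∀ k, 0 ≤ α k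

namespace QueueingNetwork

variable {J K : ℕ} (N : QueueingNetwork J K)

/-- The constituency matrix. -/
def C : Matrix (Fin J) (Fin K) ℝ :=
  Matrix.of fun j k => if N.station k = j then 1 else 0

/-- The diagonal matrix of the mean service times. -/
def M : Matrix (Fin K) (Fin K) ℝ := Matrix.diagonal N.m

/-- Ratio matrices: `Δ k j = δ k ≥ 0` if class `k` is served at station `j`, `Δ k j = 0` otherwise,
and `C M Δ = I`, i.e. the proportions `δ k * m k` of the classes of a station add up to one. -/
structure IsRatioMatrix (Δ : Matrix (Fin K) (Fin J) ℝ) : Prop where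
  nonneg : ∀ k j, 0 ≤ Δ k j
  off_station : ∀ k j, N.station k ≠ j → Δ k j = 0
  normalized : N.C * N.M * Δ = 1

/-- Static-priority ratio matrices: in the column of station `j` the only nonzero entry is `1 / m k`,
for one class `k` of that station (its lowest-priority class). -/
structure IsStaticPriority (Δ : Matrix (Fin K) (Fin J) ℝ) : Prop where
  isRatioMatrix : N.IsRatioMatrix Δ
  lowest : ∀ j, ∃ k, N.station k = j ∧ Δ k j = 1 / N.m k ∧
    ∀ l, N.station l = j → l ≠ k → Δ l j = 0

/-- For a static-priority `Δ`: the class `k` is not the lowest-priority class of its station. -/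
def IsHighPriority (Δ : Matrix (Fin K) (Fin J) ℝ) (k : Fin K) : Prop :=
  Δ k (N.station k) = 0

/-- The tie-breaking order of each station is given by the permutation `prio` of the classes: among
the classes of a station, the one with the smallest value of `prio` comes first. The identity is
"lowest index first". `N.NotAfter prio i k` says that `i` and `k` share their station and that `i`
does not come after `k`. -/
def NotAfter (prio : Equiv.Perm (Fin K)) (i k : Fin K) : Prop :=
  N.station i = N.station k ∧ prio i ≤ prio k

open scoped Classical in
/-- `ε_k⁺`: the total excess over target of the classes of the station of `k` that are above target
and do not come after `k` in the tie-breaking order. -/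
def excessUpTo (prio : Equiv.Perm (Fin K)) (ε : Fin K → ℝ) (k : Fin K) : ℝ :=
  ∑ i with N.NotAfter prio i k ∧ 0 < ε i, ε i

open scoped Classical in
/-- The share of the station of `k` that goes to those classes not after `k` that are not below
target, when class `i` gets the share `u i`. -/
def serviceUpTo (prio : Equiv.Perm (Fin K)) (ε u : Fin K → ℝ) (k : Fin K) : ℝ :=
  ∑ i with N.NotAfter prio i k ∧ 0 ≤ ε i, u i

/-- Solutions of the fluid model equations, on the time axis `[0, ∞)`, of the queue-ratio policy with
ratio matrix `Δ` and tie-breaking order `prio` (values at negative times are irrelevant).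

`T` and `Y` are nondecreasing and `Y t = e t - C T t`, so both are Lipschitz continuous on `[0, ∞)`;
hence the Stieltjes differentials are `dT_i = Ṫ_i dt` and `dY_j = Ẏ_j dt`, and the two
complementarity conditions are written with these densities. -/
structure FluidSolution (Δ : Matrix (Fin K) (Fin J) ℝ) (prio : Equiv.Perm (Fin K)) where
  /-- fluid levels -/
  Z : ℝ → Fin K → ℝ
  /-- workloads -/
  W : ℝ → Fin J → ℝ
  /-- distances from the target proportions -/
  ε : ℝ → Fin K → ℝ
  /-- cumulative allocations -/
  T : ℝ → Fin K → ℝ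
  /-- cumulative idle times -/
  Y : ℝ → Fin J → ℝ
  Z_nonneg : ∀ t, 0 ≤ t → ∀ k, 0 ≤ Z t k
  Z_eq : ∀ t, 0 ≤ t → Z t = Z 0 + t • N.α - ((1 - N.Pᵀ) * N.M⁻¹) *ᵥ T t
  W_eq : ∀ t, 0 ≤ t → W t = (N.C * N.M) *ᵥ Z t
  ε_eq : ∀ t, 0 ≤ t → ε t = Z t - (Δ * N.C * N.M) *ᵥ Z t
  T_zero : T 0 = 0
  T_mono : ∀ k, MonotoneOn (fun t => T t k) (Set.Ici 0)
  Y_eq : ∀ t, 0 ≤ t → Y t = (fun _ => t) - N.C *ᵥ T t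
  Y_mono : ∀ j, MonotoneOn (fun t => Y t j) (Set.Ici 0)
  /-- A station idles only when it has no workload: `∫ W_j dY_j = 0`. -/
  nonidling : ∀ j, ∀ t, 0 ≤ t →
    ∫ s in (0 : ℝ)..t, W s j * deriv (fun r => Y r j) s = 0
  /-- As long as some class not after `k` is above target, the station of `k` works only on classes
  that are not after `k` and not below target. -/
  priority : ∀ k, ∀ t, 0 ≤ t →
    ∫ s in (0 : ℝ)..t, N.excessUpTo prio (ε s) k *
      (1 - N.serviceUpTo prio (ε s) (fun i => deriv (fun r => T r i) s) k) = 0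

open scoped Classical in
/-- Linear attraction, with test vector `h` and constant `c`, for the static-priority policies with
ratio matrix `Δ` (i.e. with prescribed lowest-priority classes; the high-priority classes of a
station may be ordered in any way): at every regular time `t` at which some high-priority class is
nonempty, `∑ h_k Ż_k(t) ≤ -c`, the sum being over the nonempty high-priority classes. -/
def LinearAttraction (Δ : Matrix (Fin K) (Fin J) ℝ) (h : Fin K → ℝ) (c : ℝ) : Prop :=
  ∀ (prio : Equiv.Perm (Fin K)) (X : N.FluidSolution Δ prio) (t : ℝ), 0 < t →
    DifferentiableAt ℝ X.T t →
    (∃ k, N.IsHighPriority Δ k ∧ 0 < X.Z t k) →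
    ∑ k with N.IsHighPriority Δ k ∧ 0 < X.Z t k, h k * deriv (fun r => X.Z r k) t ≤ -c

end QueueingNetwork

end

/-! Let `minRatio` at a station be the largest `w` for which every class level is at least its
target for workload `w`, and let `potential` be the `h`-weighted sum of the levels in excess of
these targets. It is nonnegative, Lipschitz along a fluid solution, and zero exactly when all
classes are on target. The theorem follows once its derivative is at most `-c` at almost every time
with some class off target (`IsRegular.deriv_potential_le`). At a station off target, some class is
above target and the class `l` attaining the minimal ratio is below it. The policy therefore
saturates the station without serving `l`. An unserved class cannot shrink, so the minimal ratio
does not decrease there, and the station adds to the derivative at most the weighted drift of its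
classes other than `l`. A station on target adds nothing: its drifts all vanish, or it is saturated
and its drifts have a common sign. It remains to bound a linear functional of the allocation rates
on the compact set cut out by these constraints (`busyDrift_le`). A maximum is attained at an
extreme point. There, either a constraint degenerates and some station can be given a type of
smaller rank without lowering the functional, or a dimension count (`notMem_extremePoints_of_free`)
shows that each busy station serves just one class and that every other station is balanced, except
possibly for one class of a saturated station. Such rates are those of a static-priority policy: `l`
is the lowest class of a busy station and the served class comes first.
`attraction_of_single_service` builds a fluid solution with these rates on `[0, 1]` and applies
linear attraction at time `1 / 2`. As fluid solutions live on `[0, ∞)`, the linear piece must be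
continued; `exists_priority_allocation` does this by a limit of time-slotted greedy schedules. -/

noncomputable section

/-! ### Drifts and ratio matrices in coordinates. -/

namespace QueueingNetwork

variable {J K : ℕ} (N : QueueingNetwork J K)

/-- The rate at which the class levels change because of the allocation rates `u`. -/
def netFlow : (Fin K → ℝ) →ₗ[ℝ] (Fin K → ℝ) :=
  Matrix.mulVecLin (-((1 - N.Pᵀ) * N.M⁻¹))

/-- The time derivative of the class levels under the allocation rates `u`. -/
def drift (u : Fin K → ℝ) : Fin K → ℝ := N.α + N.netFlow u

lemma M_inv : N.M⁻¹ = Matrix.diagonal fun k => (N.m k)⁻¹ := by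
  apply Matrix.inv_eq_left_inv
  rw [M, Matrix.diagonal_mul_diagonal, ← Matrix.diagonal_one]
  congr 1
  funext k
  exact inv_mul_cancel₀ (N.m_pos k).ne'

lemma netFlow_eq (u : Fin K → ℝ) : N.netFlow u = -(((1 - N.Pᵀ) * N.M⁻¹) *ᵥ u) := by
  rw [netFlow, Matrix.mulVecLin_apply, Matrix.neg_mulVec]

lemma netFlow_apply (u : Fin K → ℝ) (k : Fin K) :
    N.netFlow u k = ∑ i, N.P i k * (u i / N.m i) - u k / N.m k := by
  have h1 : (N.M⁻¹ *ᵥ u) = fun i => u i / N.m i := by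
    funext i
    rw [M_inv, Matrix.mulVec_diagonal, div_eq_inv_mul]
  rw [netFlow_eq, ← Matrix.mulVec_mulVec, h1, Matrix.sub_mulVec, Matrix.one_mulVec]
  simp [Matrix.mulVec, dotProduct]

lemma drift_apply (u : Fin K → ℝ) (k : Fin K) :
    N.drift u k = N.α k + ∑ i, N.P i k * (u i / N.m i) - u k / N.m k := by
  rw [drift, Pi.add_apply, netFlow_apply]; ring

/-- A class that gets no service has no outflow, only external arrivals and routed inflow. -/
lemma drift_nonneg_of_eq_zero {u : Fin K → ℝ} (hu : ∀ i, 0 ≤ u i) {k : Fin K} (hk : u k = 0) :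
    0 ≤ N.drift u k := by
  rw [drift_apply, hk, zero_div, sub_zero]
  exact add_nonneg (N.α_nonneg k) (Finset.sum_nonneg fun i _ =>
    mul_nonneg (N.P_nonneg i k) (div_nonneg (hu i) (N.m_pos i).le))

lemma C_mulVec (v : Fin K → ℝ) (j : Fin J) :
    (N.C *ᵥ v) j = ∑ i with N.station i = j, v i := by
  simp [C, Matrix.mulVec, dotProduct, Finset.sum_filter]

lemma CM_mulVec (z : Fin K → ℝ) (j : Fin J) :
    ((N.C * N.M) *ᵥ z) j = ∑ i with N.station i = j, N.m i * z i := by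
  rw [← Matrix.mulVec_mulVec, C_mulVec]
  simp [M, Matrix.mulVec_diagonal]

variable {N}

namespace IsRatioMatrix

variable {Δ : Matrix (Fin K) (Fin J) ℝ}

lemma mulVec_apply (hΔ : N.IsRatioMatrix Δ) (z : Fin K → ℝ) (k : Fin K) :
    ((Δ * N.C * N.M) *ᵥ z) k =
      Δ k (N.station k) * ∑ i with N.station i = N.station k, N.m i * z i := by
  rw [Matrix.mul_assoc, ← Matrix.mulVec_mulVec, ← CM_mulVec]
  simp only [Matrix.mulVec, dotProduct]
  rw [Finset.sum_eq_single (N.station k)]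
  · intro j _ hj
    rw [hΔ.off_station k j (Ne.symm hj), zero_mul]
  · simp

lemma sum_eq_one (hΔ : N.IsRatioMatrix Δ) (j : Fin J) :
    ∑ i with N.station i = j, N.m i * Δ i (N.station i) = 1 := by
  have h : ((N.C * N.M) *ᵥ fun k => Δ k j) j = 1 := by
    have h' := congrFun (congrFun hΔ.normalized j) j
    rwa [Matrix.one_apply_eq, Matrix.mul_apply] at h'
  rw [CM_mulVec] at h
  rw [← h]
  refine Finset.sum_congr rfl fun i hi => ?_
  rw [(Finset.mem_filter.1 hi).2]

lemma exists_pos (hΔ : N.IsRatioMatrix Δ) (j : Fin J) :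
    ∃ k, N.station k = j ∧ 0 < Δ k (N.station k) := by
  by_contra! hcon
  have h := hΔ.sum_eq_one j
  rw [Finset.sum_eq_zero] at h
  · norm_num at h
  · intro i hi
    rw [le_antisymm (hcon i (Finset.mem_filter.1 hi).2) (hΔ.nonneg _ _), mul_zero]

end IsRatioMatrix

end QueueingNetwork

/-! ### Time-slotted greedy schedules for a static priority order. -/

namespace QueueingNetwork

variable {J K : ℕ} (N : QueueingNetwork J K)

/-- The sum of `v i` over the classes `i` that share the station of `k` and do not come after `k`. -/
def upTo (prio : Equiv.Perm (Fin K)) (v : Fin K → ℝ) (k : Fin K) : ℝ :=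
  ∑ i with N.station i = N.station k ∧ prio i ≤ prio k, v i

lemma upTo_sub (prio : Equiv.Perm (Fin K)) (v w : Fin K → ℝ) (k : Fin K) :
    N.upTo prio (v - w) k = N.upTo prio v k - N.upTo prio w k := by
  simp [upTo, Finset.sum_sub_distrib]

/-- The effort spent on class `k` in a time slot of length `τ` that starts with the levels `z`, when
each station serves the present contents in the order given by `prio`. -/
def greedy (prio : Equiv.Perm (Fin K)) (τ : ℝ) (z : Fin K → ℝ) (k : Fin K) : ℝ :=
  min (N.upTo prio (N.m * z) k) τ - min (N.upTo prio (N.m * z) k - N.m k * z k) τ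

section Greedy

variable {N} {prio : Equiv.Perm (Fin K)} {τ : ℝ} {z : Fin K → ℝ}

lemma greedy_nonneg (hz : ∀ k, 0 ≤ z k) (k : Fin K) : 0 ≤ N.greedy prio τ z k :=
  sub_nonneg.2 (min_le_min_right _ (sub_le_self _ (mul_nonneg (N.m_pos k).le (hz k))))

lemma greedy_le_content (hz : ∀ k, 0 ≤ z k) (k : Fin K) : N.greedy prio τ z k ≤ N.m k * z k := by
  have := mul_nonneg (N.m_pos k).le (hz k)
  unfold greedy
  rcases min_cases (N.upTo prio (N.m * z) k) τ with h | h <;>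
  rcases min_cases (N.upTo prio (N.m * z) k - N.m k * z k) τ with h' | h' <;> linarith

/-- On a set of classes of one station that is closed under going earlier in the order, the
differences of minima defining `greedy` telescope. The induction adds the last class `a` of the set,
for which `upTo` is the total content of the set. -/
lemma sum_greedy (hτ : 0 ≤ τ) (s : Finset (Fin K)) :
    (∀ i ∈ s, ∀ l ∈ s, N.station l = N.station i) →
    (∀ i ∈ s, ∀ l, N.station l = N.station i → prio l ≤ prio i → l ∈ s) →
    ∑ i ∈ s, N.greedy prio τ z i = min (∑ i ∈ s, N.m i * z i) τ := by
  induction s using Finset.induction_on_max_value prio with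
  | empty => simp [hτ]
  | insert a s ha hmax ih =>
    intro hst hlow
    have hlow' : ∀ i ∈ s, ∀ l, N.station l = N.station i → prio l ≤ prio i → l ∈ s := by
      intro i hi l hl hli
      rcases Finset.mem_insert.1 (hlow i (Finset.mem_insert_of_mem hi) l hl hli) with rfl | h
      · exact absurd (prio.injective (le_antisymm (hmax i hi) hli) ▸ hi) ha
      · exact h
    have hup : N.upTo prio (N.m * z) a = N.m a * z a + ∑ i ∈ s, N.m i * z i := by
      rw [← Finset.sum_insert (f := fun i => N.m i * z i) ha, upTo]
      refine Finset.sum_congr (Finset.ext fun i => ?_) fun i _ => rfl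
      simp only [Finset.mem_filter, Finset.mem_univ, true_and]
      constructor
      · rintro ⟨h1, h2⟩
        exact hlow a (Finset.mem_insert_self _ _) i h1 h2
      · intro hi
        refine ⟨hst a (Finset.mem_insert_self _ _) i hi, ?_⟩
        rcases Finset.mem_insert.1 hi with rfl | h
        · exact le_rfl
        · exact hmax i h
    rw [Finset.sum_insert ha, Finset.sum_insert ha,
      ih (fun i hi l hl => hst i (Finset.mem_insert_of_mem hi) l (Finset.mem_insert_of_mem hl)) hlow',
      greedy, hup, add_sub_cancel_left, sub_add_cancel]

lemma upTo_greedy (hτ : 0 ≤ τ) (k : Fin K) :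
    N.upTo prio (N.greedy prio τ z) k = min (N.upTo prio (N.m * z) k) τ := by
  refine sum_greedy hτ _ ?_ ?_
  · intro i hi l hl
    simp only [Finset.mem_filter, Finset.mem_univ, true_and] at hi hl
    rw [hl.1, hi.1]
  · intro i hi l h1 h2
    simp only [Finset.mem_filter, Finset.mem_univ, true_and] at hi ⊢
    exact ⟨h1.trans hi.1, h2.trans hi.2⟩

lemma stationSum_greedy_le (hτ : 0 ≤ τ) (j : Fin J) :
    ∑ i with N.station i = j, N.greedy prio τ z i ≤ τ := by
  rw [sum_greedy hτ]
  · exact min_le_right _ _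
  · intro i hi l hl
    simp only [Finset.mem_filter, Finset.mem_univ, true_and] at hi hl
    rw [hl, hi]
  · intro i hi l h1 _
    simp only [Finset.mem_filter, Finset.mem_univ, true_and] at hi ⊢
    exact h1.trans hi

lemma greedy_le (hτ : 0 ≤ τ) (hz : ∀ k, 0 ≤ z k) (k : Fin K) : N.greedy prio τ z k ≤ τ :=
  (Finset.single_le_sum (s := {i | N.station i = N.station k}) (fun i _ => greedy_nonneg hz i)
    (by simp)).trans (stationSum_greedy_le hτ (N.station k))

end Greedy

/-- Cumulative efforts after `n` slots of length `τ`, with the greedy rule in each slot. -/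
def slots (prio : Equiv.Perm (Fin K)) (τ : ℝ) (z₀ : Fin K → ℝ) : ℕ → Fin K → ℝ
  | 0 => 0
  | n + 1 => slots prio τ z₀ n +
      N.greedy prio τ (z₀ + (n * τ) • N.α + N.netFlow (slots prio τ z₀ n))

/-- Class levels after `n` slots of length `τ`, with the greedy rule in each slot. -/
def slotLevel (prio : Equiv.Perm (Fin K)) (τ : ℝ) (z₀ : Fin K → ℝ) (n : ℕ) : Fin K → ℝ :=
  z₀ + (n * τ) • N.α + N.netFlow (N.slots prio τ z₀ n)

/-- A bound for the rate of change of the total workload in the slotted system. -/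
def rateBound : ℝ := ∑ k, N.m k * (N.α k + ∑ i, N.P i k * (1 / N.m i) + 1 / N.m k)

section Slots

variable {N} {prio : Equiv.Perm (Fin K)} {τ : ℝ} {z₀ : Fin K → ℝ}

lemma slots_succ (n : ℕ) : N.slots prio τ z₀ (n + 1) =
    N.slots prio τ z₀ n + N.greedy prio τ (N.slotLevel prio τ z₀ n) := rfl

lemma slotLevel_succ (n : ℕ) : N.slotLevel prio τ z₀ (n + 1) = N.slotLevel prio τ z₀ n +
    (τ • N.α + N.netFlow (N.greedy prio τ (N.slotLevel prio τ z₀ n))) := by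
  rw [slotLevel, slots_succ, map_add, slotLevel]
  push_cast
  module

/-- The effort in a slot never exceeds the content present when the slot starts; what flows in
during a slot can only be served in later slots. -/
lemma slotLevel_nonneg (hτ : 0 ≤ τ) (hz₀ : ∀ k, 0 ≤ z₀ k) (n : ℕ) (k : Fin K) :
    0 ≤ N.slotLevel prio τ z₀ n k := by
  induction n generalizing k with
  | zero => simpa [slotLevel, slots] using hz₀ k
  | succ n ih =>
    rw [slotLevel_succ]
    simp only [Pi.add_apply, Pi.smul_apply, smul_eq_mul, netFlow_apply]
    have h1 : N.greedy prio τ (N.slotLevel prio τ z₀ n) k / N.m k ≤ N.slotLevel prio τ z₀ n k := by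
      rw [div_le_iff₀' (N.m_pos k)]
      exact greedy_le_content ih k
    have h2 : 0 ≤ ∑ i, N.P i k * (N.greedy prio τ (N.slotLevel prio τ z₀ n) i / N.m i) :=
      Finset.sum_nonneg fun i _ => mul_nonneg (N.P_nonneg i k)
        (div_nonneg (greedy_nonneg ih i) (N.m_pos i).le)
    have h3 := mul_nonneg hτ (N.α_nonneg k)
    linarith

lemma slots_mono (hτ : 0 ≤ τ) (hz₀ : ∀ k, 0 ≤ z₀ k) (k : Fin K) :
    Monotone fun n => N.slots prio τ z₀ n k := by
  refine monotone_nat_of_le_succ fun n => ?_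
  rw [slots_succ]
  exact le_add_of_nonneg_right (greedy_nonneg (slotLevel_nonneg hτ hz₀ n) k)

lemma stationSum_slots_sub_le (hτ : 0 ≤ τ) (j : Fin J) {a b : ℕ} (hab : a ≤ b) :
    ∑ i with N.station i = j, (N.slots prio τ z₀ b i - N.slots prio τ z₀ a i) ≤ (b - a) * τ := by
  induction b, hab using Nat.le_induction with
  | base => simp
  | succ b _ ih =>
    have h := stationSum_greedy_le (N := N) (prio := prio) (z := N.slotLevel prio τ z₀ b) hτ j
    simp only [slots_succ, Pi.add_apply, add_sub_right_comm, Finset.sum_add_distrib] at ih ⊢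
    push_cast
    linarith

lemma abs_upTo_slotLevel_succ_sub_le (hτ : 0 ≤ τ) (hz₀ : ∀ k, 0 ≤ z₀ k) (n : ℕ) (k : Fin K) :
    |N.upTo prio (N.m * N.slotLevel prio τ z₀ (n + 1)) k
      - N.upTo prio (N.m * N.slotLevel prio τ z₀ n) k| ≤ N.rateBound * τ := by
  have hz := slotLevel_nonneg (N := N) (prio := prio) hτ hz₀ n
  have key : ∀ i, |N.m i * (τ * N.α i
      + N.netFlow (N.greedy prio τ (N.slotLevel prio τ z₀ n)) i)|
      ≤ N.m i * (N.α i + ∑ l, N.P l i * (1 / N.m l) + 1 / N.m i) * τ := by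
    intro i
    rw [abs_mul, abs_of_pos (N.m_pos i), mul_assoc]
    refine mul_le_mul_of_nonneg_left ?_ (N.m_pos i).le
    rw [netFlow_apply]
    have h1 : 0 ≤ ∑ l, N.P l i * (N.greedy prio τ (N.slotLevel prio τ z₀ n) l / N.m l) :=
      Finset.sum_nonneg fun l _ => mul_nonneg (N.P_nonneg l i)
        (div_nonneg (greedy_nonneg hz l) (N.m_pos l).le)
    have h2 : ∑ l, N.P l i * (N.greedy prio τ (N.slotLevel prio τ z₀ n) l / N.m l)
        ≤ (∑ l, N.P l i * (1 / N.m l)) * τ := by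
      rw [Finset.sum_mul]
      refine Finset.sum_le_sum fun l _ => ?_
      rw [mul_assoc]
      refine mul_le_mul_of_nonneg_left ?_ (N.P_nonneg l i)
      rw [one_div_mul_eq_div]
      exact div_le_div_of_nonneg_right (greedy_le hτ hz l) (N.m_pos l).le
    have h3 : 0 ≤ N.greedy prio τ (N.slotLevel prio τ z₀ n) i / N.m i :=
      div_nonneg (greedy_nonneg hz i) (N.m_pos i).le
    have h4 : N.greedy prio τ (N.slotLevel prio τ z₀ n) i / N.m i ≤ 1 / N.m i * τ := by
      rw [one_div_mul_eq_div]
      exact div_le_div_of_nonneg_right (greedy_le hτ hz i) (N.m_pos i).le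
    have h5 := mul_nonneg hτ (N.α_nonneg i)
    rw [abs_le]
    constructor <;> nlinarith
  rw [← upTo_sub, upTo, rateBound, Finset.sum_mul]
  refine (Finset.abs_sum_le_sum_abs _ _).trans ?_
  refine (Finset.sum_le_sum fun i _ => ?_).trans
    (Finset.sum_le_sum_of_subset_of_nonneg (Finset.subset_univ _)
      fun i _ _ => (abs_nonneg _).trans (key i))
  refine le_trans (le_of_eq ?_) (key i)
  rw [slotLevel_succ]
  simp only [Pi.sub_apply, Pi.mul_apply, Pi.add_apply, Pi.smul_apply, smul_eq_mul]
  congr 1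
  ring

/-- In terms of elapsed time `τ * |b - a|` the Lipschitz constant does not depend on `τ`. Hence
content that is positive in the limit stays positive on a time window common to all fine
discretizations. -/
lemma abs_upTo_slotLevel_sub_le (hτ : 0 ≤ τ) (hz₀ : ∀ k, 0 ≤ z₀ k) (a b : ℕ) (k : Fin K) :
    |N.upTo prio (N.m * N.slotLevel prio τ z₀ b) k
      - N.upTo prio (N.m * N.slotLevel prio τ z₀ a) k| ≤ N.rateBound * τ * |(b : ℝ) - a| := by
  wlog hab : a ≤ b generalizing a b
  · rw [abs_sub_comm, abs_sub_comm (b : ℝ)]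
    exact this b a (le_of_not_ge hab)
  rw [abs_of_nonneg (sub_nonneg.2 (Nat.cast_le.2 hab) : (0 : ℝ) ≤ b - a)]
  induction b, hab using Nat.le_induction with
  | base => simp
  | succ b _ ih =>
    have h := abs_upTo_slotLevel_succ_sub_le (N := N) (prio := prio) hτ hz₀ b k
    refine (abs_sub_le _ (N.upTo prio (N.m * N.slotLevel prio τ z₀ b) k) _).trans ?_
    push_cast
    linarith

/-- With at least `τ` of work present at the start of each slot, the minimum in `upTo_greedy` is
always `τ`, so no capacity is lost to later classes or to idling. -/
lemma upTo_slots_sub_eq (hτ : 0 ≤ τ) {k : Fin K} {a b : ℕ} (hab : a ≤ b)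
    (h : ∀ n, a ≤ n → n < b → τ ≤ N.upTo prio (N.m * N.slotLevel prio τ z₀ n) k) :
    N.upTo prio (N.slots prio τ z₀ b) k - N.upTo prio (N.slots prio τ z₀ a) k = (b - a) * τ := by
  induction b, hab using Nat.le_induction with
  | base => simp
  | succ b hb ih =>
    have h1 := ih fun n hn hnb => h n hn (hnb.trans (Nat.lt_succ_self b))
    have h2 := upTo_greedy (N := N) (prio := prio) (z := N.slotLevel prio τ z₀ b) hτ k
    rw [min_eq_right (h b hb (Nat.lt_succ_self b))] at h2
    have h3 : N.upTo prio (N.slots prio τ z₀ (b + 1)) k = N.upTo prio (N.slots prio τ z₀ b) k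
        + N.upTo prio (N.greedy prio τ (N.slotLevel prio τ z₀ b)) k := by
      simp [upTo, slots_succ, Finset.sum_add_distrib]
    rw [h3, h2]
    push_cast
    linarith

end Slots

end QueueingNetwork

/-! ### Continuous-time priority allocations as limits of slotted ones. -/

namespace QueueingNetwork

variable {J K : ℕ} (N : QueueingNetwork J K)

open Filter Topology

/-- For the work-conserving policy that serves the classes of each station in the order given by
`prio`, cumulative allocations of a fluid model exist for every initial state. -/
theorem exists_priority_allocation (prio : Equiv.Perm (Fin K)) {z₀ : Fin K → ℝ}
    (hz₀ : ∀ k, 0 ≤ z₀ k) :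
    ∃ T : ℝ → Fin K → ℝ, T 0 = 0 ∧
      (∀ k s t, 0 ≤ s → s ≤ t → T s k ≤ T t k) ∧
      (∀ j s t, 0 ≤ s → s ≤ t → ∑ i with N.station i = j, (T t i - T s i) ≤ t - s) ∧
      (∀ t, 0 ≤ t → ∀ k, 0 ≤ (z₀ + t • N.α + N.netFlow (T t)) k) ∧
      ∀ t, 0 ≤ t → ∀ k, 0 < N.upTo prio (N.m * (z₀ + t • N.α + N.netFlow (T t))) k →
        ∃ δ > 0, ∀ a b, 0 ≤ a → t - δ < a → a ≤ b → b < t + δ →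
          N.upTo prio (T b) k - N.upTo prio (T a) k = b - a := by
  let τ : ℕ → ℝ := fun n => 1 / ((n : ℝ) + 1)
  have hτpos : ∀ n, 0 < τ n := fun n => by positivity
  have hτ : ∀ n, 0 ≤ τ n := fun n => (hτpos n).le
  let idx : ℕ → ℝ → ℕ := fun n t => ⌊t * ((n : ℝ) + 1)⌋₊
  -- Along a nonprincipal ultrafilter, bounded sequences converge at every time at once, so no
  -- diagonal subsequence or equicontinuity argument is needed.
  let U : Ultrafilter ℕ := hyperfilter ℕ
  have hU : (U : Filter ℕ) ≤ atTop := by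
    rw [← Nat.cofinite_eq_atTop]; exact hyperfilter_le_cofinite
  have hτlim : Tendsto τ U (𝓝 0) := tendsto_one_div_add_atTop_nhds_zero_nat.mono_left hU
  have hidx_mono : ∀ n s t, s ≤ t → idx n s ≤ idx n t := fun n s t hst =>
    Nat.floor_le_floor (mul_le_mul_of_nonneg_right hst (by positivity))
  have hidx_le : ∀ n t, 0 ≤ t → idx n t * τ n ≤ t := by
    intro n t ht
    have := Nat.floor_le (show 0 ≤ t * ((n : ℝ) + 1) by positivity)
    simp only [idx, τ]
    rw [mul_one_div, div_le_iff₀ (by positivity)]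
    exact this
  have hidx_lt : ∀ n t, t < idx n t * τ n + τ n := by
    intro n t
    have := Nat.lt_floor_add_one (t * ((n : ℝ) + 1))
    simp only [idx, τ]
    rw [← add_one_mul, mul_one_div, lt_div_iff₀ (by positivity)]
    exact this
  have hidx_lim : ∀ t, 0 ≤ t → Tendsto (fun n => idx n t * τ n) U (𝓝 t) := by
    intro t ht
    refine tendsto_of_tendsto_of_tendsto_of_le_of_le (g := fun n => t - τ n) (h := fun _ => t)
      ?_ tendsto_const_nhds (fun n => ?_) fun n => hidx_le n t ht
    · simpa using tendsto_const_nhds.sub hτlim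
    · have := hidx_lt n t
      simp only
      linarith
  let D : ℕ → ℝ → Fin K → ℝ := fun n t => N.slots prio (τ n) z₀ (idx n t)
  have hD_mono : ∀ n k s t, s ≤ t → D n s k ≤ D n t k := fun n k s t hst =>
    slots_mono (hτ n) hz₀ k (hidx_mono n s t hst)
  have hD_zero : ∀ n, D n 0 = 0 := fun n => by simp [D, idx, slots]
  have hD_sum : ∀ n j s t, s ≤ t → ∑ i with N.station i = j, (D n t i - D n s i)
      ≤ idx n t * τ n - idx n s * τ n := by
    intro n j s t hst
    rw [← sub_mul]
    exact stationSum_slots_sub_le (hτ n) j (hidx_mono n s t hst)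
  have hlim : ∀ t : ℝ, ∃ x : Fin K → ℝ, 0 ≤ t → Tendsto (fun n => D n t) U (𝓝 x) := by
    intro t
    by_cases ht : 0 ≤ t
    swap
    · exact ⟨0, fun h => absurd h ht⟩
    have hmem : ∀ n, D n t ∈ Set.Icc (0 : Fin K → ℝ) (fun _ => t) := by
      intro n
      have h0 : ∀ k, 0 ≤ D n t k := fun k => by
        have := hD_mono n k 0 t ht
        rwa [hD_zero] at this
      refine ⟨h0, fun k => ?_⟩
      have h1 := hD_sum n (N.station k) 0 t ht
      rw [hD_zero] at h1
      simp only [Pi.zero_apply, sub_zero] at h1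
      have h2 : D n t k ≤ ∑ i with N.station i = N.station k, D n t i :=
        Finset.single_le_sum (s := {i | N.station i = N.station k}) (fun i _ => h0 i) (by simp)
      have h3 := hidx_le n t ht
      have h4 : 0 ≤ idx n 0 * τ n := mul_nonneg (Nat.cast_nonneg _) (hτ n)
      linarith
    obtain ⟨x, -, hx⟩ := (isCompact_Icc (a := (0 : Fin K → ℝ)) (b := fun _ => t)).ultrafilter_le_nhds
      (U.map fun n => D n t) (by
        rw [le_principal_iff]
        exact Filter.mem_map.2 (Filter.univ_mem' hmem))
    exact ⟨x, fun _ => hx⟩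
  choose T hT using hlim
  have hTk : ∀ t, 0 ≤ t → ∀ k, Tendsto (fun n => D n t k) U (𝓝 (T t k)) := fun t ht k =>
    (tendsto_pi_nhds.1 (hT t ht)) k
  have hZ : ∀ t, 0 ≤ t → Tendsto (fun n => N.slotLevel prio (τ n) z₀ (idx n t)) U
      (𝓝 (z₀ + t • N.α + N.netFlow (T t))) := by
    intro t ht
    refine (tendsto_const_nhds.add ((hidx_lim t ht).smul tendsto_const_nhds)).add ?_
    exact ((LinearMap.continuous_of_finiteDimensional N.netFlow).tendsto _).comp (hT t ht)
  have hupTo : ∀ k, Continuous fun v : Fin K → ℝ => N.upTo prio v k := by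
    intro k; unfold upTo; fun_prop
  refine ⟨T, ?_, ?_, ?_, ?_, ?_⟩
  · exact tendsto_nhds_unique (hT 0 le_rfl) (by simp [hD_zero])
  · intro k s t hs hst
    exact le_of_tendsto_of_tendsto' (hTk s hs k) (hTk t (hs.trans hst) k)
      fun n => hD_mono n k s t hst
  · intro j s t hs hst
    exact le_of_tendsto_of_tendsto'
      (tendsto_finsetSum _ fun i _ => (hTk t (hs.trans hst) i).sub (hTk s hs i))
      ((hidx_lim t (hs.trans hst)).sub (hidx_lim s hs)) fun n => hD_sum n j s t hst
  · intro t ht k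
    exact ge_of_tendsto' ((tendsto_pi_nhds.1 (hZ t ht)) k)
      fun n => slotLevel_nonneg (hτ n) hz₀ _ k
  · intro t ht k hpos
    set η := N.upTo prio (N.m * (z₀ + t • N.α + N.netFlow (T t))) k with hη
    have hVlim : Tendsto (fun n => N.upTo prio (N.m * N.slotLevel prio (τ n) z₀ (idx n t)) k) U
        (𝓝 η) :=
      (((hupTo k).comp (continuous_const.mul continuous_id)).tendsto _).comp (hZ t ht)
    set L := N.rateBound with hL
    -- Within time `δ + τ` of `t` the content up to `k` moves by at most `|L| * (δ + τ) ≤ η / 2`.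
    -- Starting from at least `3 * η / 4`, it stays above `η / 4 ≥ τ`, as full slots require. The `+
    -- 1` avoids a vanishing denominator.
    refine ⟨η / (4 * (|L| + 1)), by positivity, fun a b ha hta hab hbt => ?_⟩
    set δ := η / (4 * (|L| + 1)) with hδ
    have hev : ∀ᶠ n in (U : Filter ℕ), τ n ≤ η / 4 ∧ |L| * τ n ≤ η / 4 ∧
        η / 4 * 3 ≤ N.upTo prio (N.m * N.slotLevel prio (τ n) z₀ (idx n t)) k := by
      refine ((hτlim.eventually_le_const (by linarith)).and ?_)
      refine Eventually.and ?_ (hVlim.eventually_const_le (by linarith))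
      have : Tendsto (fun n => |L| * τ n) U (𝓝 (|L| * 0)) := hτlim.const_mul _
      rw [mul_zero] at this
      exact this.eventually_le_const (by linarith)
    have heq : ∀ᶠ n in (U : Filter ℕ), N.upTo prio (D n b) k - N.upTo prio (D n a) k
        = idx n b * τ n - idx n a * τ n := by
      filter_upwards [hev] with n ⟨h1, h2, h3⟩
      rw [← sub_mul]
      refine upTo_slots_sub_eq (hτ n) (hidx_mono n a b hab) fun m hma hmb => ?_
      have h4 := abs_upTo_slotLevel_sub_le (N := N) (prio := prio) (hτ n) hz₀ (idx n t) m k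
      have h5 : (idx n a : ℝ) * τ n ≤ m * τ n :=
        mul_le_mul_of_nonneg_right (Nat.cast_le.2 hma) (hτ n)
      have h6 : ((m : ℝ) + 1) * τ n ≤ idx n b * τ n := by
        refine mul_le_mul_of_nonneg_right ?_ (hτ n)
        exact_mod_cast hmb
      have h7 : τ n * |(m : ℝ) - idx n t| ≤ δ + τ n := by
        rw [← abs_of_pos (hτpos n), ← abs_mul, abs_of_pos (hτpos n), abs_le]
        have := hidx_lt n t
        have := hidx_lt n a
        have := hidx_le n t ht
        have := hidx_le n b (ha.trans hab)
        constructor <;> nlinarith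
      have h8 : L * τ n * |(m : ℝ) - idx n t| ≤ η / 2 := by
        have h9 : 0 ≤ τ n * |(m : ℝ) - idx n t| := mul_nonneg (hτ n) (abs_nonneg _)
        have h10 : |L| * δ ≤ η / 4 := by
          rw [hδ, mul_div_assoc', div_le_div_iff₀ (by positivity) (by norm_num)]
          nlinarith [abs_nonneg L]
        rw [mul_assoc]
        calc L * (τ n * |(m : ℝ) - idx n t|) ≤ |L| * (τ n * |(m : ℝ) - idx n t|) :=
              mul_le_mul_of_nonneg_right (le_abs_self L) h9
          _ ≤ |L| * (δ + τ n) := mul_le_mul_of_nonneg_left h7 (abs_nonneg L)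
          _ ≤ η / 2 := by rw [mul_add]; linarith
      have h11 := (abs_le.1 h4).1
      linarith
    have hl1 : Tendsto (fun n => N.upTo prio (D n b) k - N.upTo prio (D n a) k) U
        (𝓝 (N.upTo prio (T b) k - N.upTo prio (T a) k)) :=
      (((hupTo k).tendsto _).comp (hT b (ha.trans hab))).sub
        (((hupTo k).tendsto _).comp (hT a ha))
    refine tendsto_nhds_unique hl1 (Tendsto.congr' (EventuallyEq.symm heq) ?_)
    exact (hidx_lim b (ha.trans hab)).sub (hidx_lim a ha)

end QueueingNetwork

/-! ### Static priority as a queue-ratio policy. -/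

namespace QueueingNetwork

variable {J K : ℕ} {N : QueueingNetwork J K}

section Order

variable {prio : Equiv.Perm (Fin K)} {ε v : Fin K → ℝ} {k : Fin K}

lemma excessUpTo_nonneg : 0 ≤ N.excessUpTo prio ε k := by
  classical
  exact Finset.sum_nonneg fun i hi => (Finset.mem_filter.1 hi).2.2.le

lemma excessUpTo_pos_iff :
    0 < N.excessUpTo prio ε k ↔ ∃ i, N.NotAfter prio i k ∧ 0 < ε i := by
  classical
  constructor
  · intro h
    obtain ⟨i, hi, -⟩ := Finset.exists_ne_zero_of_sum_ne_zero h.ne'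
    exact ⟨i, (Finset.mem_filter.1 hi).2⟩
  · rintro ⟨i, hi⟩
    exact Finset.sum_pos (fun l hl => (Finset.mem_filter.1 hl).2.2)
      ⟨i, Finset.mem_filter.2 ⟨Finset.mem_univ i, hi⟩⟩

lemma serviceUpTo_le (hv : ∀ i, 0 ≤ v i) :
    N.serviceUpTo prio ε v k ≤ ∑ i with N.station i = N.station k, v i := by
  classical
  refine Finset.sum_le_sum_of_subset_of_nonneg (fun i hi => ?_) fun i _ _ => hv i
  exact Finset.mem_filter.2 ⟨Finset.mem_univ i, (Finset.mem_filter.1 hi).2.1.1⟩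

/-- `serviceUpTo` leaves out classes below target, so the rate of `l` comes on top of it. If the
service up to `k` already exhausts the station, `l` gets nothing. -/
lemma serviceUpTo_add_le (hv : ∀ i, 0 ≤ v i) {l : Fin K} (hl : N.station l = N.station k)
    (hε : ε l < 0) :
    N.serviceUpTo prio ε v k + v l ≤ ∑ i with N.station i = N.station k, v i := by
  classical
  unfold serviceUpTo
  rw [add_comm, ← Finset.sum_insert (a := l)]
  · refine Finset.sum_le_sum_of_subset_of_nonneg (fun i hi => ?_) fun i _ _ => hv i
    rcases Finset.mem_insert.1 hi with rfl | hi
    · exact Finset.mem_filter.2 ⟨Finset.mem_univ i, hl⟩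
    · exact Finset.mem_filter.2 ⟨Finset.mem_univ i, (Finset.mem_filter.1 hi).2.1.1⟩
  · simp [hε]

lemma upTo_le_serviceUpTo (hv : ∀ i, 0 ≤ v i) {i : Fin K} (hi : N.NotAfter prio i k)
    (hε : ∀ l, N.NotAfter prio l i → 0 ≤ ε l) :
    N.upTo prio v i ≤ N.serviceUpTo prio ε v k := by
  classical
  refine Finset.sum_le_sum_of_subset_of_nonneg (fun l hl => ?_) fun i _ _ => hv i
  have hl' : N.NotAfter prio l i := (Finset.mem_filter.1 hl).2
  exact Finset.mem_filter.2 ⟨Finset.mem_univ l,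
    ⟨hl'.1.trans hi.1, hl'.2.trans hi.2⟩, hε l hl'⟩

/-- Every integer-valued key is refined by a linear order of the classes. -/
lemma exists_prio_of_key (key : Fin K → ℕ) :
    ∃ prio : Equiv.Perm (Fin K), ∀ i k, key i < key k → prio i < prio k := by
  refine ⟨(Tuple.sort key).symm, fun i k h => ?_⟩
  by_contra! hcon
  have := Tuple.monotone_sort key hcon
  simp only [Function.comp_apply, Equiv.apply_symm_apply] at this
  omega

end Order

/-- The static-priority ratio matrix with the lowest-priority classes `low`. -/
def staticRatio (N : QueueingNetwork J K) (low : Fin J → Fin K) : Matrix (Fin K) (Fin J) ℝ :=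
  Matrix.of fun k j => if k = low j then 1 / N.m k else 0

section StaticRatio

variable {low : Fin J → Fin K}

lemma isStaticPriority_staticRatio (hlow : ∀ j, N.station (low j) = j) :
    N.IsStaticPriority (N.staticRatio low) := by
  refine ⟨⟨fun k j => ?_, fun k j hk => ?_, ?_⟩, fun j => ⟨low j, hlow j, ?_, fun l _ hl => ?_⟩⟩
  · unfold staticRatio
    rw [Matrix.of_apply]
    split_ifs
    · exact one_div_nonneg.2 (N.m_pos k).le
    · exact le_rfl
  · unfold staticRatio
    rw [Matrix.of_apply, if_neg]
    rintro rfl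
    exact hk (hlow j)
  · ext j l
    have h : (N.C * N.M * N.staticRatio low) j l
        = ((N.C * N.M) *ᵥ fun k => N.staticRatio low k l) j := by
      rw [Matrix.mul_apply]; rfl
    rw [h, CM_mulVec, Matrix.one_apply]
    simp only [staticRatio, Matrix.of_apply, mul_ite, mul_zero]
    rw [← Finset.sum_filter, Finset.filter_filter]
    split_ifs with hjl
    · subst hjl
      rw [show (Finset.univ.filter fun a => N.station a = j ∧ a = low j) = {low j} from ?_]
      · rw [Finset.sum_singleton, mul_one_div_cancel (N.m_pos _).ne']
      · ext a
        simp only [Finset.mem_filter, Finset.mem_univ, true_and, Finset.mem_singleton]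
        exact ⟨fun h => h.2, fun h => ⟨h ▸ hlow j, h⟩⟩
    · refine Finset.sum_eq_zero fun a ha => ?_
      obtain ⟨h1, h2⟩ := (Finset.mem_filter.1 ha).2
      exact absurd (h1.symm.trans (h2 ▸ hlow l)) hjl
  · simp [staticRatio]
  · simp [staticRatio, hl]

lemma isHighPriority_staticRatio {k : Fin K} :
    N.IsHighPriority (N.staticRatio low) k ↔ k ≠ low (N.station k) := by
  simp [IsHighPriority, staticRatio, (N.m_pos k).ne']

/-- A high-priority class has target zero, so all of its fluid is excess. Together with
`excess_staticRatio_low_nonpos` this makes the queue-ratio rule for `staticRatio` an ordinary static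
priority rule with the classes `low` last. -/
lemma excess_staticRatio (hlow : ∀ j, N.station (low j) = j) (z : Fin K → ℝ) {k : Fin K}
    (hk : k ≠ low (N.station k)) :
    (z - (N.staticRatio low * N.C * N.M) *ᵥ z) k = z k := by
  rw [Pi.sub_apply, (isStaticPriority_staticRatio hlow).isRatioMatrix.mulVec_apply]
  simp [staticRatio, hk]

/-- The target of the lowest class is the level at which it would hold the entire workload of its
station. -/
lemma excess_staticRatio_low_nonpos (hlow : ∀ j, N.station (low j) = j) {z : Fin K → ℝ}
    (hz : ∀ k, 0 ≤ z k) (j : Fin J) :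
    (z - (N.staticRatio low * N.C * N.M) *ᵥ z) (low j) ≤ 0 := by
  rw [Pi.sub_apply, (isStaticPriority_staticRatio hlow).isRatioMatrix.mulVec_apply]
  simp only [staticRatio, Matrix.of_apply, hlow, if_true, sub_nonpos]
  rw [one_div_mul_eq_div, le_div_iff₀ (N.m_pos _), mul_comm]
  exact Finset.single_le_sum (f := fun i => N.m i * z i)
    (fun i _ => mul_nonneg (N.m_pos i).le (hz i))
    (Finset.mem_filter.2 ⟨Finset.mem_univ _, hlow j⟩)

end StaticRatio

open MeasureTheory

lemma ae_differentiableAt_of_monotoneOn {T : ℝ → Fin K → ℝ}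
    (hT : ∀ k, MonotoneOn (fun t => T t k) (Set.Ici 0)) :
    ∀ᵐ t : ℝ, 0 < t → ∀ k, DifferentiableAt ℝ (fun r => T r k) t := by
  have h : ∀ᵐ t : ℝ, ∀ k, t ∈ Set.Ici (0 : ℝ) →
      DifferentiableWithinAt ℝ (fun r => T r k) (Set.Ici 0) t :=
    ae_all_iff.2 fun k => (hT k).ae_differentiableWithinAt_of_mem
  filter_upwards [h] with t ht hpos k
  exact (ht k hpos.le).differentiableAt (Ici_mem_nhds hpos)

lemma deriv_nonneg_of_monotoneOn {f : ℝ → ℝ} (hf : MonotoneOn f (Set.Ici 0)) {t : ℝ} (ht : 0 < t) :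
    0 ≤ deriv f t := by
  rw [← derivWithin_of_mem_nhds (Ici_mem_nhds ht)]
  exact hf.derivWithin_nonneg

variable {prio : Equiv.Perm (Fin K)} {low : Fin J → Fin K}

/-- Fluid solutions for a static-priority ratio matrix are obtained from cumulative allocations that
serve each station in the order given by `prio`, if `prio` puts the lowest-priority classes last. -/
lemma exists_fluidSolution_of_allocation (hlow : ∀ j, N.station (low j) = j)
    (hlast : ∀ k, prio k ≤ prio (low (N.station k)))
    {T : ℝ → Fin K → ℝ} {z₀ : Fin K → ℝ} (hT0 : T 0 = 0)
    (hT : ∀ k, MonotoneOn (fun t => T t k) (Set.Ici 0))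
    (hY : ∀ j s t, 0 ≤ s → s ≤ t → ∑ i with N.station i = j, (T t i - T s i) ≤ t - s)
    (hZ : ∀ t, 0 ≤ t → ∀ k, 0 ≤ (z₀ + t • N.α + N.netFlow (T t)) k)
    (hfull : ∀ᵐ t : ℝ, 0 < t → (∀ k, DifferentiableAt ℝ (fun r => T r k) t) →
      ∀ k, 0 < N.upTo prio (N.m * (z₀ + t • N.α + N.netFlow (T t))) k →
        N.upTo prio (fun i => deriv (fun r => T r i) t) k = 1) :
    ∃ X : N.FluidSolution (N.staticRatio low) prio,
      X.T = T ∧ X.Z = fun t => z₀ + t • N.α + N.netFlow (T t) := by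
  set Z : ℝ → Fin K → ℝ := fun t => z₀ + t • N.α + N.netFlow (T t) with hZdef
  have hYmono : ∀ j, MonotoneOn (fun t => t - ∑ i with N.station i = j, T t i) (Set.Ici 0) := by
    intro j s hs t ht hst
    have := hY j s t hs hst
    rw [Finset.sum_sub_distrib] at this
    simp only
    linarith
  have hYderiv : ∀ t, (∀ k, DifferentiableAt ℝ (fun r => T r k) t) → ∀ j,
      deriv (fun r => r - ∑ i with N.station i = j, T r i) t
        = 1 - ∑ i with N.station i = j, deriv (fun r => T r i) t := by
    intro t hd j
    have h1 : HasDerivAt (fun r => ∑ i with N.station i = j, T r i)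
        (∑ i with N.station i = j, deriv (fun r => T r i) t) t :=
      HasDerivAt.fun_sum fun i _ => (hd i).hasDerivAt
    exact ((hasDerivAt_id t).sub h1).deriv
  have hgood : ∀ᵐ t : ℝ, 0 < t →
      (∀ j, (∑ i with N.station i = j, N.m i * Z t i) *
        deriv (fun r => r - ∑ i with N.station i = j, T r i) t = 0) ∧
      ∀ k, N.excessUpTo prio (Z t - (N.staticRatio low * N.C * N.M) *ᵥ Z t) k *
        (1 - N.serviceUpTo prio (Z t - (N.staticRatio low * N.C * N.M) *ᵥ Z t)
          (fun i => deriv (fun r => T r i) t) k) = 0 := by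
    filter_upwards [hfull, ae_differentiableAt_of_monotoneOn hT] with t h1 h2 ht
    have hd := h2 ht
    have hf := h1 ht hd
    have hv : ∀ i, 0 ≤ deriv (fun r => T r i) t := fun i => deriv_nonneg_of_monotoneOn (hT i) ht
    have hsum : ∀ j, ∑ i with N.station i = j, deriv (fun r => T r i) t ≤ 1 := by
      intro j
      have := deriv_nonneg_of_monotoneOn (hYmono j) ht
      rw [hYderiv t hd] at this
      linarith
    constructor
    · intro j
      rw [hYderiv t hd]
      have hall : ∀ w : Fin K → ℝ, N.upTo prio w (low j) = ∑ i with N.station i = j, w i := by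
        intro w
        refine Finset.sum_congr (Finset.ext fun i => ?_) fun _ _ => rfl
        simp only [Finset.mem_filter, Finset.mem_univ, true_and, hlow]
        exact ⟨fun h => h.1, fun h => ⟨h, h ▸ hlast i⟩⟩
      rcases (Finset.sum_nonneg fun i _ => mul_nonneg (N.m_pos i).le (hZ t ht.le i) :
        0 ≤ ∑ i with N.station i = j, N.m i * Z t i).eq_or_lt with h | h
      · rw [← h, zero_mul]
      · have h3 := hf (low j) (by rw [hall]; exact h)
        rw [hall] at h3
        rw [h3, sub_self, mul_zero]
    · intro k
      rcases (excessUpTo_nonneg : 0 ≤ N.excessUpTo prio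
        (Z t - (N.staticRatio low * N.C * N.M) *ᵥ Z t) k).eq_or_lt with h | h
      · rw [← h, zero_mul]
      obtain ⟨i, hik, hi⟩ := excessUpTo_pos_iff.1 h
      -- The lowest class comes last, so if it did not come after `i` it would be `i`; but it is
      -- never above target. Hence all classes up to `i` have excess equal to their level and count
      -- in `serviceUpTo`.
      have hhigh : ∀ l, N.NotAfter prio l i → l ≠ low (N.station l) := by
        intro l hl hl'
        have h3 : prio i ≤ prio l := by rw [hl', hl.1]; exact hlast i
        have h4 : l = i := prio.injective (le_antisymm hl.2 h3)
        rw [← h4, hl'] at hi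
        exact absurd hi (not_lt.2 (excess_staticRatio_low_nonpos hlow (hZ t ht.le) _))
      have hi' := hhigh i ⟨rfl, le_rfl⟩
      rw [excess_staticRatio hlow _ hi'] at hi
      have h5 : N.upTo prio (fun i => deriv (fun r => T r i) t) i = 1 := by
        refine hf i ?_
        refine (mul_pos (N.m_pos i) hi).trans_le ?_
        exact Finset.single_le_sum (f := fun l => (N.m * Z t) l)
          (fun l _ => mul_nonneg (N.m_pos l).le (hZ t ht.le l)) (by simp)
      have h6 := upTo_le_serviceUpTo hv hik
        (ε := Z t - (N.staticRatio low * N.C * N.M) *ᵥ Z t) fun l hl => by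
          rw [excess_staticRatio hlow _ (hhigh l hl)]
          exact hZ t ht.le l
      have h7 := (serviceUpTo_le (N := N) (prio := prio) (k := k)
        (ε := Z t - (N.staticRatio low * N.C * N.M) *ᵥ Z t) hv).trans (hsum _)
      rw [le_antisymm h7 (h5 ▸ h6), sub_self, mul_zero]
  have hint : ∀ f : ℝ → ℝ, (∀ᵐ t : ℝ, 0 < t → f t = 0) → ∀ t, 0 ≤ t →
      ∫ s in (0 : ℝ)..t, f s = 0 := by
    intro f hf t ht
    refine intervalIntegral.integral_zero_ae ?_
    filter_upwards [hf] with s hs hs'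
    rw [Set.uIoc_of_le ht] at hs'
    exact hs hs'.1
  refine ⟨{
    Z := Z
    W := fun t => (N.C * N.M) *ᵥ Z t
    ε := fun t => Z t - (N.staticRatio low * N.C * N.M) *ᵥ Z t
    T := T
    Y := fun t => (fun _ => t) - N.C *ᵥ T t
    Z_nonneg := hZ
    Z_eq := fun t _ => ?_
    W_eq := fun t _ => rfl
    ε_eq := fun t _ => rfl
    T_zero := hT0
    T_mono := hT
    Y_eq := fun t _ => rfl
    Y_mono := fun j => ?_
    nonidling := fun j t ht => ?_
    priority := fun k t ht => ?_ }, rfl, rfl⟩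
  · simp only [hZdef, netFlow_eq, hT0, Matrix.mulVec_zero, zero_smul, neg_zero, add_zero,
      sub_eq_add_neg]
  · simpa only [Pi.sub_apply, C_mulVec] using hYmono j
  · simp only [Pi.sub_apply, C_mulVec, CM_mulVec]
    exact hint _ (by filter_upwards [hgood] with s hs h using (hs h).1 j) t ht
  · exact hint _ (by filter_upwards [hgood] with s hs h using (hs h).2 k) t ht

end QueueingNetwork

/-! ### Linear attraction along a linear piece of a static-priority solution. -/

namespace QueueingNetwork

variable {J K : ℕ} {N : QueueingNetwork J K}

open Filter Topology MeasureTheory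

/-- If the total allocation to the classes up to `k` grows at rate one near `t`, then the allocation
rates at `t` add up to one. -/
lemma upTo_deriv_eq_one {prio : Equiv.Perm (Fin K)} {T : ℝ → Fin K → ℝ} {t : ℝ} {k : Fin K}
    (hd : ∀ i, DifferentiableAt ℝ (fun r => T r i) t)
    (h : ∀ᶠ r in 𝓝[>] t, N.upTo prio (T r) k - N.upTo prio (T t) k = r - t) :
    N.upTo prio (fun i => deriv (fun r => T r i) t) k = 1 := by
  have h1 : HasDerivAt (fun r => N.upTo prio (T r) k)
      (N.upTo prio (fun i => deriv (fun r => T r i) t) k) t :=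
    HasDerivAt.fun_sum fun i _ => (hd i).hasDerivAt
  have h2 : HasDerivWithinAt (fun r => N.upTo prio (T r) k) 1 (Set.Ioi t) t := by
    have h3 : HasDerivWithinAt (fun r => N.upTo prio (T t) k + (r - t)) 1 (Set.Ioi t) t :=
      (((hasDerivAt_id t).sub_const t).const_add _).hasDerivWithinAt
    refine h3.congr_of_eventuallyEq ?_ (by simp)
    filter_upwards [h] with r hr
    rw [← hr]; ring
  exact (uniqueDiffWithinAt_Ioi t).eq_deriv _ h1.hasDerivWithinAt h2

/-- Linear attraction evaluated along a linear piece of a static-priority fluid solution: at a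
station in `A` all classes are nonempty and only the class `top j` is served; at the other stations
the high-priority classes are and stay empty. -/
theorem attraction_of_single_service {h : Fin K → ℝ} {c : ℝ} {low top : Fin J → Fin K}
    (hlow : ∀ j, N.station (low j) = j)
    (hattr : N.LinearAttraction (N.staticRatio low) h c)
    {A : Fin J → Prop} [DecidablePred A] (hA : ∃ j, A j) {u : Fin K → ℝ} (hu : ∀ k, 0 ≤ u k)
    (htop : ∀ j, A j → N.station (top j) = j ∧ top j ≠ low j ∧ u (top j) = 1 ∧
      ∀ k, N.station k = j → k ≠ top j → u k = 0)
    (hbal : ∀ k, ¬ A (N.station k) → k ≠ low (N.station k) → N.drift u k = 0)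
    (hsum : ∀ j, ¬ A j → ∑ i with N.station i = j, u i = 1 ∨
      (N.drift u (low j) = 0 ∧ ∑ i with N.station i = j, u i ≤ 1)) :
    ∑ k with A (N.station k) ∧ k ≠ low (N.station k), h k * N.drift u k ≤ -c := by
  classical
  -- The order puts `top` first and `low` last. At stations outside `A` the position of `top` does
  -- not matter.
  obtain ⟨prio, hprio⟩ := exists_prio_of_key (K := K) fun k =>
    if k = low (N.station k) then 2 else if k = top (N.station k) then 0 else 1
  have hlast : ∀ k, prio k ≤ prio (low (N.station k)) := by
    intro k
    by_cases hk : k = low (N.station k)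
    · exact le_of_eq (congrArg prio hk)
    · refine (hprio k _ ?_).le
      simp only [hlow, if_true, hk, if_false]
      split_ifs <;> norm_num
  have hfirst : ∀ k, A (N.station k) → prio (top (N.station k)) ≤ prio k := by
    intro k hk
    obtain ⟨h1, h2, -⟩ := htop _ hk
    by_cases hkt : k = top (N.station k)
    · exact le_of_eq (congrArg prio hkt.symm)
    · refine (hprio _ k ?_).le
      simp only [h1, h2, if_true, hkt, if_false]
      split_ifs <;> norm_num
  have hstation : ∀ j, ∑ i with N.station i = j, u i ≤ 1 := by
    intro j
    by_cases hj : A j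
    · obtain ⟨h1, -, h3, h4⟩ := htop j hj
      rw [Finset.sum_eq_single_of_mem (top j) (Finset.mem_filter.2 ⟨Finset.mem_univ _, h1⟩), h3]
      exact fun k hk hkt => h4 k (Finset.mem_filter.1 hk).2 hkt
    · rcases hsum j hj with h1 | h1
      · exact h1.le
      · exact h1.2
  obtain ⟨B, hB0, hB⟩ : ∃ B : ℝ, 0 < B ∧ ∀ k, |N.drift u k| < B := by
    refine ⟨∑ k, |N.drift u k| + 1, by positivity, fun k => ?_⟩
    have := Finset.single_le_sum (f := fun k => |N.drift u k|) (s := Finset.univ)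
      (fun i _ => abs_nonneg _) (Finset.mem_univ k)
    linarith
  -- Classes that are to be nonempty start at `B`, which exceeds every drift in absolute value, so
  -- they stay positive on `[0, 1]`. Outside `A` only the lowest class of a saturated station is
  -- filled. All classes starting at zero have zero drift.
  set z₀ : Fin K → ℝ := fun k => if A (N.station k) ∨ (k = low (N.station k) ∧
    ∑ i with N.station i = N.station k, u i = 1) then B else 0 with hz₀def
  have hempty : ∀ k, ¬ (A (N.station k) ∨ (k = low (N.station k) ∧
      ∑ i with N.station i = N.station k, u i = 1)) → z₀ k = 0 ∧ N.drift u k = 0 := by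
    intro k hk
    refine ⟨if_neg hk, ?_⟩
    rw [not_or, not_and] at hk
    by_cases hkl : k = low (N.station k)
    · have := (hsum _ hk.1).resolve_left (hk.2 hkl)
      rw [← hkl] at this
      exact this.1
    · exact hbal k hk.1 hkl
  have hpos : ∀ k, (A (N.station k) ∨ (k = low (N.station k) ∧
      ∑ i with N.station i = N.station k, u i = 1)) → ∀ t, 0 ≤ t → t ≤ 1 →
      0 < z₀ k + t * N.drift u k := by
    intro k hk t ht0 ht1
    have h1 : z₀ k = B := if_pos hk
    have h2 : |t * N.drift u k| ≤ |N.drift u k| := by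
      rw [abs_mul, abs_of_nonneg ht0]
      exact mul_le_of_le_one_left (abs_nonneg _) ht1
    have h3 := (abs_lt.1 (h2.trans_lt (hB k))).1
    rw [h1]
    linarith
  have hnonneg : ∀ t, 0 ≤ t → t ≤ 1 → ∀ k, 0 ≤ z₀ k + t * N.drift u k := by
    intro t ht0 ht1 k
    by_cases hk : A (N.station k) ∨ (k = low (N.station k) ∧
      ∑ i with N.station i = N.station k, u i = 1)
    · exact (hpos k hk t ht0 ht1).le
    · obtain ⟨h1, h2⟩ := hempty k hk
      rw [h1, h2, mul_zero, add_zero]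
  set z₁ : Fin K → ℝ := z₀ + N.drift u with hz₁
  -- Continuation after time `1`, from the state `z₁` reached by the linear piece, under the same
  -- order.
  obtain ⟨S, hS0, hSmono, hSsum, hSZ, hSfull⟩ := N.exists_priority_allocation prio (z₀ := z₁)
    fun k => by simpa [hz₁] using hnonneg 1 zero_le_one le_rfl k
  set T : ℝ → Fin K → ℝ := fun t => if t ≤ 1 then t • u else u + S (t - 1) with hTdef
  have hTle : ∀ t, t ≤ 1 → T t = t • u := fun t ht => if_pos ht
  have hTge : ∀ t, 1 ≤ t → T t = u + S (t - 1) := by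
    intro t ht
    rcases ht.eq_or_lt with rfl | ht
    · rw [hTle 1 le_rfl, sub_self, hS0, one_smul, add_zero]
    · exact if_neg (not_le.2 ht)
  have hZle : ∀ t, t ≤ 1 → z₀ + t • N.α + N.netFlow (T t) = z₀ + t • N.drift u := by
    intro t ht
    rw [hTle t ht, map_smul, drift, smul_add, add_assoc]
  have hZge : ∀ t, 1 ≤ t → z₀ + t • N.α + N.netFlow (T t)
      = z₁ + (t - 1) • N.α + N.netFlow (S (t - 1)) := by
    intro t ht
    rw [hTge t ht, map_add, hz₁, drift]
    module
  have hTmono : ∀ k, MonotoneOn (fun t => T t k) (Set.Ici 0) := by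
    intro k s hs t ht hst
    simp only
    rcases le_total t 1 with ht1 | ht1
    · rw [hTle t ht1, hTle s (hst.trans ht1)]
      exact mul_le_mul_of_nonneg_right hst (hu k)
    · rcases le_total s 1 with hs1 | hs1
      · rw [hTle s hs1, hTge t ht1]
        have h1 := hSmono k 0 (t - 1) le_rfl (by linarith)
        rw [hS0] at h1
        simp only [Pi.zero_apply, Pi.smul_apply, smul_eq_mul, Pi.add_apply] at h1 ⊢
        nlinarith [hu k]
      · rw [hTge t ht1, hTge s hs1]
        have h1 := hSmono k (s - 1) (t - 1) (by linarith) (by linarith)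
        simp only [Pi.add_apply]
        linarith
  have hTsum1 : ∀ j s t, s ≤ t → t ≤ 1 →
      ∑ i with N.station i = j, (T t i - T s i) ≤ t - s := by
    intro j s t hst ht
    rw [hTle t ht, hTle s (hst.trans ht)]
    simp only [Pi.smul_apply, smul_eq_mul, ← sub_mul]
    rw [← Finset.mul_sum]
    have := hstation j
    nlinarith
  have hTsum2 : ∀ j s t, 1 ≤ s → s ≤ t →
      ∑ i with N.station i = j, (T t i - T s i) ≤ t - s := by
    intro j s t hs hst
    rw [hTge t (hs.trans hst), hTge s hs]
    simp only [Pi.add_apply, add_sub_add_left_eq_sub]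
    have := hSsum j (s - 1) (t - 1) (by linarith) (by linarith)
    linarith
  have hTsum : ∀ j s t, 0 ≤ s → s ≤ t →
      ∑ i with N.station i = j, (T t i - T s i) ≤ t - s := by
    intro j s t _ hst
    rcases le_total t 1 with ht1 | ht1
    · exact hTsum1 j s t hst ht1
    · rcases le_total s 1 with hs1 | hs1
      · have h1 := hTsum1 j s 1 hs1 le_rfl
        have h2 := hTsum2 j 1 t le_rfl ht1
        have h3 : ∑ i with N.station i = j, (T t i - T s i) =
            ∑ i with N.station i = j, (T 1 i - T s i)
              + ∑ i with N.station i = j, (T t i - T 1 i) := by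
          rw [← Finset.sum_add_distrib]
          exact Finset.sum_congr rfl fun i _ => by ring
        linarith
      · exact hTsum2 j s t hs1 hst
  -- The linear piece obeys the priority rule. At a station in `A` the whole effort goes to the
  -- first class. Elsewhere only the lowest class can be nonempty; it is last, so content up to `k`
  -- forces `k` to be that class and the sum to run over the whole station.
  have hupTo_u : ∀ t : ℝ, 0 < t → t < 1 → ∀ k,
      0 < N.upTo prio (N.m * (z₀ + t • N.drift u)) k → N.upTo prio u k = 1 := by
    intro t ht0 ht1 k hk
    refine le_antisymm ((Finset.sum_le_sum_of_subset_of_nonneg (fun i hi => ?_)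
      fun i _ _ => hu i).trans (hstation (N.station k))) ?_
    · exact Finset.mem_filter.2 ⟨Finset.mem_univ i, (Finset.mem_filter.1 hi).2.1⟩
    by_cases hkA : A (N.station k)
    · obtain ⟨h1, -, h3, -⟩ := htop _ hkA
      rw [← h3]
      exact Finset.single_le_sum (f := u) (fun i _ => hu i)
        (Finset.mem_filter.2 ⟨Finset.mem_univ _, h1, hfirst k hkA⟩)
    · obtain ⟨i, hi, hne⟩ := Finset.exists_ne_zero_of_sum_ne_zero hk.ne'
      obtain ⟨h1, h2⟩ := (Finset.mem_filter.1 hi).2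
      have h3 : i = low (N.station i) ∧ ∑ l with N.station l = N.station i, u l = 1 := by
        by_contra hcon
        obtain ⟨h4, h5⟩ := hempty i (by rw [h1] at hcon ⊢; exact not_or.2 ⟨hkA, hcon⟩)
        simp [h4, h5] at hne
      rw [← h3.2, h1]
      refine le_of_eq (Finset.sum_congr (Finset.ext fun l => ?_) fun _ _ => rfl)
      simp only [Finset.mem_filter, Finset.mem_univ, true_and]
      refine ⟨fun hl => ⟨hl, ?_⟩, fun hl => hl.1⟩
      have h4 := hlast l
      rw [hl, ← h1, ← h3.1] at h4
      exact h4.trans h2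
  obtain ⟨X, hXT, hXZ⟩ := exists_fluidSolution_of_allocation (N := N) (z₀ := z₀) hlow hlast
    (T := T) (by rw [hTle 0 zero_le_one, zero_smul]) hTmono hTsum (fun t ht k => by
      rcases le_total t 1 with ht1 | ht1
      · rw [hZle t ht1]; exact hnonneg t ht ht1 k
      · rw [hZge t ht1]; exact hSZ (t - 1) (by linarith) k) (by
    -- The junction of the two pieces is a null set.
    have h1 : ∀ᵐ t : ℝ, t ≠ 1 := by
      simp [ae_iff, measure_singleton]
    filter_upwards [h1] with t htne ht0 hd k hk
    refine upTo_deriv_eq_one hd ?_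
    rcases lt_or_gt_of_ne htne with ht1 | ht1
    · rw [hZle t ht1.le] at hk
      have h2 := hupTo_u t ht0 ht1 k hk
      filter_upwards [Ioo_mem_nhdsGT ht1] with r hr
      rw [hTle r hr.2.le, hTle t ht1.le, ← upTo_sub, ← sub_smul]
      unfold upTo at h2 ⊢
      simp only [Pi.smul_apply, smul_eq_mul]
      rw [← Finset.mul_sum, h2, mul_one]
    · rw [hZge t ht1.le] at hk
      obtain ⟨δ, hδ, h2⟩ := hSfull (t - 1) (by linarith) k hk
      filter_upwards [Ioo_mem_nhdsGT (show t < t + δ by linarith)] with r hr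
      rw [hTge r (by linarith [hr.1]), hTge t ht1.le, ← upTo_sub, add_sub_add_left_eq_sub, upTo_sub,
        h2 (t - 1) (r - 1) (by linarith) (by linarith) (by linarith [hr.1]) (by linarith [hr.2])]
      ring)
  have hT_half : T =ᶠ[𝓝 (1 / 2)] fun t => t • u := by
    filter_upwards [Iio_mem_nhds (show (1 / 2 : ℝ) < 1 by norm_num)] with t ht
    exact hTle t (le_of_lt ht)
  have hdrift : ∀ k, deriv (fun r => X.Z r k) (1 / 2) = N.drift u k := by
    intro k
    have h1 : (fun r => X.Z r k) =ᶠ[𝓝 (1 / 2)] fun r => z₀ k + r * N.drift u k := by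
      filter_upwards [Iio_mem_nhds (show (1 / 2 : ℝ) < 1 by norm_num)] with t ht
      rw [hXZ]
      simp only
      rw [hZle t (le_of_lt ht)]
      rfl
    rw [h1.deriv_eq]
    have := ((hasDerivAt_id (1 / 2 : ℝ)).mul_const (N.drift u k)).const_add (z₀ k)
    rw [one_mul] at this
    exact this.deriv
  have hZhalf : ∀ k, X.Z (1 / 2) k = z₀ k + 1 / 2 * N.drift u k := by
    intro k
    rw [hXZ]
    simp only
    rw [hZle (1 / 2) (by norm_num)]
    rfl
  have hiff : ∀ k, (N.IsHighPriority (N.staticRatio low) k ∧ 0 < X.Z (1 / 2) k) ↔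
      (A (N.station k) ∧ k ≠ low (N.station k)) := by
    intro k
    rw [isHighPriority_staticRatio, hZhalf]
    constructor
    · rintro ⟨h1, h2⟩
      refine ⟨?_, h1⟩
      by_contra h3
      obtain ⟨h4, h5⟩ := hempty k (by
        rintro (h6 | h6)
        · exact h3 h6
        · exact h1 h6.1)
      rw [h4, h5] at h2
      norm_num at h2
    · rintro ⟨h1, h2⟩
      exact ⟨h2, hpos k (Or.inl h1) _ (by norm_num) (by norm_num)⟩
  have hfin := hattr prio X (1 / 2) (by norm_num)
    (by rw [hXT]; exact (hT_half.differentiableAt_iff).2 (by fun_prop))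
    (by
      obtain ⟨j, hj⟩ := hA
      obtain ⟨h1, h2, -⟩ := htop j hj
      exact ⟨top j, (hiff _).2 ⟨by rwa [h1], by rwa [h1]⟩⟩)
  refine le_trans (le_of_eq (Finset.sum_congr (Finset.ext fun k => ?_) fun k _ => ?_)) hfin
  · simp only [Finset.mem_filter, Finset.mem_univ, true_and]
    exact (hiff k).symm
  · rw [hdrift]

end QueueingNetwork

/-! ### The set of admissible allocation rates and its extreme points. -/

namespace QueueingNetwork

variable {J K : ℕ} {N : QueueingNetwork J K}

open Filter Topology

lemma drift_add_smul (u d : Fin K → ℝ) (θ : ℝ) (k : Fin K) :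
    N.drift (u + θ • d) k = N.drift u k + θ * N.netFlow d k := by
  simp only [drift, map_add, map_smul, Pi.add_apply, Pi.smul_apply, smul_eq_mul]
  ring

lemma continuous_drift : Continuous N.drift :=
  continuous_const.add (LinearMap.continuous_of_finiteDimensional N.netFlow)

/-- The ways in which the allocation rates of a station can be constrained. -/
inductive StationType (K : ℕ)
  /-- All classes are balanced. -/
  | balanced
  /-- The station is saturated and all classes but one are balanced. -/
  | single (l : Fin K)
  /-- The station is saturated and no class decreases. -/
  | growing
  /-- The station is saturated and no class increases. -/
  | draining
  /-- The station is saturated and does not serve one of its classes. -/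
  | busy (l : Fin K)

namespace StationType

/-- The constraint that a station type puts on the allocation rates at station `j`. -/
def Admits (N : QueueingNetwork J K) (u : Fin K → ℝ) (j : Fin J) : StationType K → Prop
  | balanced => (∀ k, N.station k = j → N.drift u k = 0) ∧ ∑ i with N.station i = j, u i ≤ 1
  | single l => N.station l = j ∧ (∀ k, N.station k = j → k ≠ l → N.drift u k = 0) ∧
      ∑ i with N.station i = j, u i = 1
  | growing => (∀ k, N.station k = j → 0 ≤ N.drift u k) ∧ ∑ i with N.station i = j, u i = 1
  | draining => (∀ k, N.station k = j → N.drift u k ≤ 0) ∧ ∑ i with N.station i = j, u i = 1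
  | busy l => N.station l = j ∧ u l = 0 ∧ ∑ i with N.station i = j, u i = 1

/-- The weight of class `k` in the drift condition: at busy stations, `h k` for the classes other
than the one that must not be served. -/
def weight (h : Fin K → ℝ) : StationType K → Fin K → ℝ
  | busy l, k => if k = l then 0 else h k
  | _, _ => 0

/-- Types are refined in the order of decreasing rank. -/
def rank : StationType K → ℕ
  | balanced => 2
  | growing => 2
  | draining => 2
  | single _ => 1
  | busy _ => 0

lemma sum_le_one {u : Fin K → ℝ} {j : Fin J} {ty : StationType K} (h : ty.Admits N u j) :
    ∑ i with N.station i = j, u i ≤ 1 := by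
  cases ty with
  | balanced => exact h.2
  | single l => exact h.2.2.le
  | growing => exact h.2.le
  | draining => exact h.2.le
  | busy l => exact h.2.2.le

lemma isClosed_setOf_admits (ty : StationType K) (j : Fin J) :
    IsClosed {u : Fin K → ℝ | ty.Admits N u j} := by
  have hd : ∀ k, Continuous fun u => N.drift u k := fun k =>
    (continuous_apply k).comp continuous_drift
  have hs : Continuous fun u : Fin K → ℝ => ∑ i with N.station i = j, u i := by fun_prop
  have hall : ∀ p : Fin K → Prop, ∀ s : Fin K → Set (Fin K → ℝ), (∀ k, IsClosed (s k)) →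
      IsClosed {u : Fin K → ℝ | ∀ k, p k → u ∈ s k} := by
    intro p s hs
    simp only [Set.ofPred_forall]
    exact isClosed_iInter fun k => isClosed_iInter fun _ => hs k
  cases ty with
  | balanced =>
    exact (hall _ (fun k => {u | N.drift u k = 0}) fun k =>
      isClosed_eq (hd k) continuous_const).inter (isClosed_le hs continuous_const)
  | single l =>
    refine isClosed_const.inter (IsClosed.inter ?_ (isClosed_eq hs continuous_const))
    have := hall (fun k => N.station k = j ∧ k ≠ l) (fun k => {u | N.drift u k = 0}) fun k =>
      isClosed_eq (hd k) continuous_const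
    simp only [and_imp] at this
    exact this
  | growing =>
    exact (hall _ (fun k => {u | 0 ≤ N.drift u k}) fun k =>
      isClosed_le continuous_const (hd k)).inter (isClosed_eq hs continuous_const)
  | draining =>
    exact (hall _ (fun k => {u | N.drift u k ≤ 0}) fun k =>
      isClosed_le (hd k) continuous_const).inter (isClosed_eq hs continuous_const)
  | busy l =>
    exact isClosed_const.inter ((isClosed_eq (continuous_apply l) continuous_const).inter
      (isClosed_eq hs continuous_const))

end StationType

open StationType

/-- The allocation rates that satisfy the constraints of all stations. -/
def admissible (N : QueueingNetwork J K) (ty : Fin J → StationType K) : Set (Fin K → ℝ) :=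
  {u | (∀ k, 0 ≤ u k) ∧ ∀ j, (ty j).Admits N u j}

lemma isCompact_admissible (ty : Fin J → StationType K) : IsCompact (N.admissible ty) := by
  refine (isCompact_Icc (a := (0 : Fin K → ℝ)) (b := 1)).of_isClosed_subset ?_ ?_
  · have h1 : IsClosed {u : Fin K → ℝ | ∀ k, 0 ≤ u k} := by
      simp only [Set.ofPred_forall]
      exact isClosed_iInter fun k => isClosed_le continuous_const (continuous_apply k)
    have h2 : IsClosed {u : Fin K → ℝ | ∀ j, (ty j).Admits N u j} := by
      simp only [Set.ofPred_forall]
      exact isClosed_iInter fun j => isClosed_setOf_admits _ _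
    exact h1.inter h2
  · rintro u ⟨h1, h2⟩
    exact ⟨h1, fun k => (Finset.single_le_sum (s := {i | N.station i = N.station k})
      (fun i _ => h1 i) (by simp)).trans (StationType.sum_le_one (h2 (N.station k)))⟩

/-- A continuous linear functional on a nonempty compact set is maximal at some extreme point. -/
lemma _root_.IsCompact.exists_mem_extremePoints_forall_le {E : Type*} [AddCommGroup E] [Module ℝ E]
    [TopologicalSpace E] [T2Space E] [IsTopologicalAddGroup E] [ContinuousSMul ℝ E]
    [LocallyConvexSpace ℝ E] {s : Set E} (hs : IsCompact s) (hne : s.Nonempty)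
    (l : StrongDual ℝ E) : ∃ u ∈ s.extremePoints ℝ, ∀ v ∈ s, l v ≤ l u := by
  obtain ⟨w, hw, hmax⟩ := hs.exists_isMaxOn hne l.continuous.continuousOn
  have hexp : IsExposed ℝ s (l.toExposed s) := ContinuousLinearMap.toExposed.isExposed
  obtain ⟨u, hu⟩ := (hexp.isCompact hs).extremePoints_nonempty ⟨w, hw, fun y hy => hmax hy⟩
  exact ⟨u, hexp.isExtreme.extremePoints_subset_extremePoints hu, hu.1.2⟩

/-- A class is free if its allocation rate is not determined by the constraints that are active. -/
def IsFree (N : QueueingNetwork J K) (ty : Fin J → StationType K) (u : Fin K → ℝ) (k : Fin K) :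
    Prop :=
  0 < u k ∧ match ty (N.station k) with
    | balanced => False
    | single l => k = l
    | growing => N.drift u k ≠ 0
    | draining => N.drift u k ≠ 0
    | busy _ => True

/-- If each station is either balanced and not saturated, or has a free class, and if some station
has two of them, then the allocation rates can be changed without violating the constraints. -/
lemma notMem_extremePoints_of_free {ty : Fin J → StationType K} {u : Fin K → ℝ}
    (hu : u ∈ N.admissible ty)
    (hbal : ∀ j, ty j = balanced → ∑ i with N.station i = j, u i < 1)
    (hfree : ∀ j, ty j ≠ balanced → ∃ k, N.station k = j ∧ N.IsFree ty u k)
    {k₀ k₁ : Fin K} (hk₀ : N.IsFree ty u k₀) (hk₁ : N.IsFree ty u k₁)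
    (hst : N.station k₀ = N.station k₁) (hne : k₀ ≠ k₁) :
    u ∉ (N.admissible ty).extremePoints ℝ := by
  classical
  obtain ⟨r, hr⟩ : ∃ r : Fin J → Fin K, ∀ j, ty j ≠ balanced →
      N.station (r j) = j ∧ N.IsFree ty u (r j) := by
    have : ∀ j, ∃ k, ty j ≠ balanced → N.station k = j ∧ N.IsFree ty u k := by
      intro j
      by_cases hj : ty j = balanced
      · exact ⟨k₀, fun h => absurd hj h⟩
      · obtain ⟨k, hk⟩ := hfree j hj
        exact ⟨k, fun _ => hk⟩
    exact ⟨fun j => (this j).choose, fun j => (this j).choose_spec⟩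
  -- A free class that is not the chosen representative of its station: one unknown more than there
  -- are equations.
  obtain ⟨k₂, hk₂, hk₂r⟩ : ∃ k, N.IsFree ty u k ∧ k ≠ r (N.station k) := by
    by_cases h0 : k₀ = r (N.station k₀)
    · exact ⟨k₁, hk₁, fun h1 => hne (h0.trans (hst ▸ h1.symm))⟩
    · exact ⟨k₀, hk₀, h0⟩
  -- One equation per class for a direction `d`: unserved classes stay unserved, the representative
  -- free class keeps the station total, and served classes that are not free keep their drift. The
  -- equation of `k₂` is vacuous, so `Φ` is not surjective and has a nonzero kernel.
  let Φ : (Fin K → ℝ) →ₗ[ℝ] (Fin K → ℝ) := LinearMap.pi fun k =>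
    if u k = 0 then LinearMap.proj k
    else if N.IsFree ty u k then
      if k = r (N.station k) then ∑ i with N.station i = N.station k, LinearMap.proj i else 0
    else (LinearMap.proj k).comp N.netFlow
  have hΦ : ¬ Function.Injective Φ := by
    intro hinj
    obtain ⟨d, hd⟩ := LinearMap.injective_iff_surjective.1 hinj (Pi.single k₂ 1)
    have h1 := congrFun hd k₂
    simp [Φ, hk₂.1.ne', hk₂, hk₂r] at h1
  obtain ⟨d, hd, hd0⟩ : ∃ d, Φ d = 0 ∧ d ≠ 0 := by
    by_contra! hcon
    exact hΦ ((injective_iff_map_eq_zero Φ).2 hcon)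
  have hzero : ∀ k, u k = 0 → d k = 0 := by
    intro k hk
    have h1 := congrFun hd k
    simpa [Φ, hk] using h1
  have hsum : ∀ j, ty j ≠ balanced → ∑ i with N.station i = j, d i = 0 := by
    intro j hj
    obtain ⟨h1, h2⟩ := hr j hj
    have h3 := congrFun hd (r j)
    simpa [Φ, h2.1.ne', h2, h1] using h3
  -- An unserved class has no drift equation in `Φ`, and needs none: zero drift without service
  -- means zero inflow, so every class routed to it is unserved too and is fixed by `d`.
  have hflow : ∀ k, N.drift u k = 0 → ¬ N.IsFree ty u k → N.netFlow d k = 0 := by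
    intro k hk hkf
    by_cases hk0 : u k = 0
    · have h1 : ∀ i, 0 ≤ N.P i k * (u i / N.m i) := fun i =>
        mul_nonneg (N.P_nonneg i k) (div_nonneg (hu.1 i) (N.m_pos i).le)
      rw [drift_apply, hk0, zero_div, sub_zero] at hk
      have h2 : ∑ i, N.P i k * (u i / N.m i) = 0 :=
        le_antisymm (by linarith [N.α_nonneg k]) (Finset.sum_nonneg fun i _ => h1 i)
      rw [netFlow_apply, hzero k hk0, zero_div, sub_zero]
      refine Finset.sum_eq_zero fun i hi => ?_
      rcases mul_eq_zero.1 ((Finset.sum_eq_zero_iff_of_nonneg fun i _ => h1 i).1 h2 i hi) with h | h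
      · rw [h, zero_mul]
      · rw [hzero i ((div_eq_zero_iff.1 h).resolve_right (N.m_pos i).ne'), zero_div, mul_zero]
    · have h1 := congrFun hd k
      simpa [Φ, hk0, hkf] using h1
  have hlin : ∀ a b : ℝ, ∀ p : ℝ → Prop, (∀ᶠ x in 𝓝 a, p x) → ∀ᶠ θ in 𝓝 (0 : ℝ), p (a + θ * b) := by
    intro a b p hp
    have : Tendsto (fun θ : ℝ => a + θ * b) (𝓝 0) (𝓝 (a + 0 * b)) :=
      (continuous_const.add (continuous_id.mul continuous_const)).tendsto 0
    rw [zero_mul, add_zero] at this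
    exact this.eventually hp
  have hsumθ : ∀ (θ : ℝ) (j : Fin J), ∑ i with N.station i = j, (u + θ • d) i
      = ∑ i with N.station i = j, u i + θ * ∑ i with N.station i = j, d i := by
    intro θ j
    simp [Finset.sum_add_distrib, Finset.mul_sum]
  -- Active constraints are preserved by the kernel direction, strict inequalities by smallness of
  -- `θ`. With both signs of `θ`, `u` becomes the midpoint of a nondegenerate admissible segment.
  have hstay : ∀ᶠ θ in 𝓝 (0 : ℝ), u + θ • d ∈ N.admissible ty := by
    refine Eventually.and (eventually_all.2 fun k => ?_) (eventually_all.2 fun j => ?_)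
    · simp only [Pi.add_apply, Pi.smul_apply, smul_eq_mul]
      rcases (hu.1 k).eq_or_lt with h | h
      · simp [← h, hzero k h.symm]
      · exact hlin _ _ _ ((lt_mem_nhds h).mono fun x hx => le_of_lt hx)
    · have hj := hu.2 j
      cases hty : ty j with
      | balanced =>
        rw [hty] at hj
        refine Eventually.and (Eventually.of_forall fun θ k hk => ?_) ?_
        · rw [drift_add_smul, hj.1 k hk, hflow k (hj.1 k hk), mul_zero, add_zero]
          intro h; have := h.2; rw [hk, hty] at this; exact this
        · simp only [hsumθ]
          exact hlin _ _ _ ((gt_mem_nhds (hbal j hty)).mono fun x hx => le_of_lt hx)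
      | single l =>
        rw [hty] at hj
        refine Eventually.of_forall fun θ => ⟨hj.1, fun k hk hkl => ?_, ?_⟩
        · rw [drift_add_smul, hj.2.1 k hk hkl, hflow k (hj.2.1 k hk hkl), mul_zero, add_zero]
          intro h; have := h.2; rw [hk, hty] at this; exact hkl this
        · rw [hsumθ, hj.2.2, hsum j (by rw [hty]; nofun), mul_zero, add_zero]
      | growing =>
        rw [hty] at hj
        refine Eventually.and (eventually_all.2 fun k => ?_) (Eventually.of_forall fun θ => ?_)
        · simp only [drift_add_smul]
          by_cases hk : N.station k = j
          swap
          · exact Eventually.of_forall fun θ h => absurd h hk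
          rcases (hj.1 k hk).eq_or_lt with h | h
          · rw [← h, hflow k h.symm]
            · simp
            · intro h'; have := h'.2; rw [hk, hty] at this; exact this h.symm
          · filter_upwards [hlin _ (N.netFlow d k) _ (lt_mem_nhds h)] with θ hθ _ using le_of_lt hθ
        · rw [hsumθ, hj.2, hsum j (by rw [hty]; nofun), mul_zero, add_zero]
      | draining =>
        rw [hty] at hj
        refine Eventually.and (eventually_all.2 fun k => ?_) (Eventually.of_forall fun θ => ?_)
        · simp only [drift_add_smul]
          by_cases hk : N.station k = j
          swap
          · exact Eventually.of_forall fun θ h => absurd h hk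
          rcases (hj.1 k hk).eq_or_lt with h | h
          · rw [h, hflow k h]
            · simp
            · intro h'; have := h'.2; rw [hk, hty] at this; exact this h
          · filter_upwards [hlin _ (N.netFlow d k) _ (gt_mem_nhds h)] with θ hθ _ using le_of_lt hθ
        · rw [hsumθ, hj.2, hsum j (by rw [hty]; nofun), mul_zero, add_zero]
      | busy l =>
        rw [hty] at hj
        refine Eventually.of_forall fun θ => ⟨hj.1, ?_, ?_⟩
        · simp [hj.2.1, hzero l hj.2.1]
        · rw [hsumθ, hj.2.2, hsum j (by rw [hty]; nofun), mul_zero, add_zero]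
  have hstay' : ∀ᶠ θ in 𝓝 (0 : ℝ), u + (-θ) • d ∈ N.admissible ty := by
    have : Tendsto (fun θ : ℝ => -θ) (𝓝 0) (𝓝 0) := by simpa using (continuous_neg.tendsto (0 : ℝ))
    exact this.eventually hstay
  obtain ⟨θ, ⟨h1, h2⟩, hθ⟩ := (((hstay.and hstay').filter_mono
    (nhdsWithin_le_nhds (s := Set.Ioi (0 : ℝ)))).and self_mem_nhdsWithin).exists
  intro hext
  have h3 := (mem_extremePoints.1 hext).2 _ h1 _ h2
    ⟨1 / 2, 1 / 2, by norm_num, by norm_num, by norm_num, by module⟩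
  have h4 : θ • d = 0 := by simpa using h3.1
  exact hd0 ((smul_eq_zero.1 h4).resolve_left (ne_of_gt hθ))

end QueueingNetwork

/-! ### The drift bound for all admissible rates. -/

namespace QueueingNetwork

variable {J K : ℕ} {N : QueueingNetwork J K}

open StationType

/-- The weighted drift of the classes of the busy stations. -/
def busyDrift (N : QueueingNetwork J K) (h : Fin K → ℝ) (ty : Fin J → StationType K)
    (u : Fin K → ℝ) : ℝ :=
  ∑ k, (ty (N.station k)).weight h k * N.drift u k

lemma weight_eq_zero {h : Fin K → ℝ} {ty : StationType K} (hty : ∀ l, ty ≠ busy l) (k : Fin K) :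
    ty.weight h k = 0 := by
  cases ty with
  | busy l => exact absurd rfl (hty l)
  | _ => rfl

/-- Refining the type of a station that is not busy. -/
lemma busyDrift_le_update {h : Fin K → ℝ} {ty : Fin J → StationType K} {u : Fin K → ℝ}
    {j : Fin J} {t : StationType K} (hj : ∀ l, ty j ≠ busy l)
    (ht : ∀ k, N.station k = j → 0 ≤ t.weight h k * N.drift u k) :
    N.busyDrift h ty u ≤ N.busyDrift h (Function.update ty j t) u := by
  refine Finset.sum_le_sum fun k _ => ?_
  by_cases hk : N.station k = j
  · rw [hk, Function.update_self, weight_eq_zero hj, zero_mul]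
    exact ht k hk
  · rw [Function.update_of_ne hk]

/-- Linear attraction for the static-priority policies bounds the weighted drift of the busy
stations for all admissible allocation rates, including those that do not come from a
static-priority policy. -/
theorem busyDrift_le {h : Fin K → ℝ} {c : ℝ} (hh : ∀ k, 0 < h k)
    (hattr : ∀ Δ : Matrix (Fin K) (Fin J) ℝ, N.IsStaticPriority Δ → N.LinearAttraction Δ h c)
    (hne : ∀ j, ∃ k, N.station k = j) (ty : Fin J → StationType K)
    (hbusy : ∃ j l, ty j = busy l) {u : Fin K → ℝ} (hu : u ∈ N.admissible ty) :
    N.busyDrift h ty u ≤ -c := by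
  classical
  induction hn : ∑ j, (ty j).rank using Nat.strong_induction_on generalizing ty u with
  | _ n ih =>
  let l : (Fin K → ℝ) →ₗ[ℝ] ℝ :=
    ∑ k, (ty (N.station k)).weight h k • (LinearMap.proj k).comp N.netFlow
  have hl : ∀ v, N.busyDrift h ty v = ∑ k, (ty (N.station k)).weight h k * N.α k + l v := by
    intro v
    simp [l, busyDrift, drift, mul_add, Finset.sum_add_distrib]
  -- For fixed types the weighted drift is affine in the rates, so it suffices to treat a maximizing
  -- extreme point.
  obtain ⟨v, hv, hmax⟩ := (isCompact_admissible (N := N) ty).exists_mem_extremePoints_forall_le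
    ⟨u, hu⟩ (LinearMap.toContinuousLinearMap l)
  have huv : N.busyDrift h ty u ≤ N.busyDrift h ty v := by
    rw [hl, hl]
    exact add_le_add le_rfl (hmax u hu)
  refine huv.trans ?_
  have hvQ := hv.1
  have hv0 := hvQ.1
  by_contra hcon
  -- If `v` also satisfies the constraints of a type of smaller rank at a station that is not busy,
  -- and the new weights do not lower the functional, the induction hypothesis already gives the
  -- bound. So all such degenerations may be excluded below.
  have hretype : ∀ (j : Fin J) (t : StationType K), (∀ l, ty j ≠ busy l) → t.rank < (ty j).rank → t.Admits N v j →
      (∀ k, N.station k = j → 0 ≤ t.weight h k * N.drift v k) → False := by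
    intro j t hj hrank hadm hw
    refine hcon ((busyDrift_le_update hj hw).trans (ih _ ?_ (Function.update ty j t) ?_ ?_ rfl))
    · rw [← hn]
      refine Finset.sum_lt_sum (fun i _ => ?_) ⟨j, Finset.mem_univ j, ?_⟩
      · by_cases hi : i = j
        · rw [hi, Function.update_self]; exact hrank.le
        · rw [Function.update_of_ne hi]
      · rw [Function.update_self]; exact hrank
    · obtain ⟨i, l, hil⟩ := hbusy
      refine ⟨i, l, ?_⟩
      rw [Function.update_of_ne, hil]
      rintro rfl
      exact hj l hil
    · refine ⟨hv0, fun i => ?_⟩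
      by_cases hi : i = j
      · rw [hi, Function.update_self]; exact hadm
      · rw [Function.update_of_ne hi]; exact hvQ.2 i
  have hserved : ∀ j, ∑ i with N.station i = j, v i = 1 → ∃ k, N.station k = j ∧ 0 < v k := by
    intro j hj
    obtain ⟨k, hk, hk0⟩ := Finset.exists_ne_zero_of_sum_ne_zero (by rw [hj]; exact one_ne_zero)
    exact ⟨k, (Finset.mem_filter.1 hk).2, (hv0 k).lt_of_ne' hk0⟩
  have hbal : ∀ j, ty j = balanced → ∑ i with N.station i = j, v i < 1 := by
    intro j hty
    have hj := hvQ.2 j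
    rw [hty] at hj
    refine hj.2.lt_of_ne fun h1 => ?_
    obtain ⟨k, hk, -⟩ := hserved j h1
    exact hretype j (single k) (by rw [hty]; nofun) (by rw [hty]; exact Nat.one_lt_two)
      ⟨hk, fun i hi _ => hj.1 i hi, h1⟩ (fun i _ => by simp [weight])
  have hsingle : ∀ j l, ty j = single l → 0 < v l := by
    intro j l hty
    have hj := hvQ.2 j
    rw [hty] at hj
    refine (hv0 l).lt_of_ne' fun h1 => ?_
    refine hretype j (busy l) (by rw [hty]; nofun) (by rw [hty]; exact Nat.zero_lt_one)
      ⟨hj.1, h1, hj.2.2⟩ fun k hk => ?_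
    by_cases hkl : k = l
    · simp [weight, hkl]
    · rw [hj.2.1 k hk hkl, mul_zero]
  -- An unserved class would turn a growing station into a busy one, whose new terms are
  -- nonnegative. At a draining station an unserved class has drift both `≤ 0` and `≥ 0`.
  have hgd : ∀ k, (ty (N.station k) = growing ∨ ty (N.station k) = draining) →
      N.drift v k ≠ 0 → 0 < v k := by
    intro k hty hk
    refine (hv0 k).lt_of_ne' fun h1 => ?_
    have hj := hvQ.2 (N.station k)
    rcases hty with hty | hty
    · rw [hty] at hj
      refine hretype (N.station k) (busy k) (by rw [hty]; nofun)
        (by rw [hty]; exact Nat.zero_lt_two) ⟨rfl, h1, hj.2⟩ fun i hi => ?_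
      refine mul_nonneg ?_ (hj.1 i hi)
      simp only [weight]
      split_ifs
      · exact le_rfl
      · exact (hh i).le
    · rw [hty] at hj
      exact hk (le_antisymm (hj.1 k rfl) (drift_nonneg_of_eq_zero N hv0 h1))
  -- With at most one unbalanced class the saturated station would be of type `single`.
  have htwo : ∀ j, (ty j = growing ∨ ty j = draining) → ∃ k₀ k₁, N.station k₀ = j ∧
      N.station k₁ = j ∧ k₀ ≠ k₁ ∧ N.drift v k₀ ≠ 0 ∧ N.drift v k₁ ≠ 0 := by
    intro j hty
    have hsum1 : ∑ i with N.station i = j, v i = 1 := by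
      have hj := hvQ.2 j
      rcases hty with hty | hty <;> rw [hty] at hj <;> exact hj.2
    by_contra! hno
    obtain ⟨l, hlj, hlz⟩ : ∃ l, N.station l = j ∧
        ∀ k, N.station k = j → k ≠ l → N.drift v k = 0 := by
      by_cases hex : ∃ l, N.station l = j ∧ N.drift v l ≠ 0
      · obtain ⟨l, hlj, hl0⟩ := hex
        exact ⟨l, hlj, fun k hk hkl => hno l k hlj hk (Ne.symm hkl) hl0⟩
      · push Not at hex
        obtain ⟨l, hlj⟩ := hne j
        exact ⟨l, hlj, fun k hk _ => hex k hk⟩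
    refine hretype j (single l) ?_ ?_ ⟨hlj, hlz, hsum1⟩ (fun i _ => by simp [weight])
    · rcases hty with hty | hty <;> rw [hty] <;> nofun
    · rcases hty with hty | hty <;> rw [hty] <;> exact Nat.one_lt_two
  have hfree : ∀ j, ty j ≠ balanced → ∃ k, N.station k = j ∧ N.IsFree ty v k := by
    intro j hj
    have hadm := hvQ.2 j
    cases hty : ty j with
    | balanced => exact absurd hty hj
    | single l =>
      rw [hty] at hadm
      exact ⟨l, hadm.1, hsingle j l hty, by rw [hadm.1, hty]⟩
    | growing =>
      obtain ⟨k, -, hk, -, -, hk0, -⟩ := htwo j (Or.inl hty)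
      exact ⟨k, hk, hgd k (Or.inl (by rw [hk, hty])) hk0, by rw [hk, hty]; exact hk0⟩
    | draining =>
      obtain ⟨k, -, hk, -, -, hk0, -⟩ := htwo j (Or.inr hty)
      exact ⟨k, hk, hgd k (Or.inr (by rw [hk, hty])) hk0, by rw [hk, hty]; exact hk0⟩
    | busy l =>
      rw [hty] at hadm
      obtain ⟨k, hk, hk0⟩ := hserved j hadm.2.2
      exact ⟨k, hk, hk0, by rw [hk, hty]; trivial⟩
  have hunique : ∀ k₀ k₁, N.IsFree ty v k₀ → N.IsFree ty v k₁ → N.station k₀ = N.station k₁ →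
      k₀ = k₁ := by
    intro k₀ k₁ h0 h1 hst
    by_contra hk
    exact notMem_extremePoints_of_free hvQ hbal hfree h0 h1 hst hk hv
  -- Two unbalanced classes of such a station are both served, hence free, against extremality.
  have hnot : ∀ j, ¬ (ty j = growing ∨ ty j = draining) := by
    intro j hty
    obtain ⟨k₀, k₁, h0, h1, hk, hd0, hd1⟩ := htwo j hty
    have hf : ∀ k, N.station k = j → N.drift v k ≠ 0 → N.IsFree ty v k := by
      intro k hk hd
      refine ⟨hgd k (by rwa [hk]) hd, ?_⟩
      rw [hk]
      rcases hty with hty | hty <;> rw [hty] <;> exact hd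
    exact hk (hunique k₀ k₁ (hf k₀ h0 hd0) (hf k₁ h1 hd1) (h0.trans h1.symm))
  have hlow : ∀ j, ∃ l, N.station l = j ∧ ∀ l', (ty j = single l' ∨ ty j = busy l') → l' = l := by
    intro j
    have hadm := hvQ.2 j
    cases hty : ty j with
    | single l =>
      rw [hty] at hadm
      exact ⟨l, hadm.1, fun l' h' => by simpa [eq_comm] using h'⟩
    | busy l =>
      rw [hty] at hadm
      exact ⟨l, hadm.1, fun l' h' => by simpa [eq_comm] using h'⟩
    | _ =>
      obtain ⟨l, hlj⟩ := hne j
      exact ⟨l, hlj, by rintro l' (h | h) <;> cases h⟩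
  choose low hlowst hlow using hlow
  have htop : ∀ j, ∃ k, (∃ l, ty j = busy l) → N.station k = j ∧ 0 < v k ∧
      ∀ i, N.station i = j → i ≠ k → v i = 0 := by
    intro j
    by_cases hj : ∃ l, ty j = busy l
    · obtain ⟨l, hl⟩ := hj
      obtain ⟨k, hk, hkf⟩ := hfree j (by rw [hl]; nofun)
      refine ⟨k, fun _ => ⟨hk, hkf.1, fun i hi hik => ?_⟩⟩
      by_contra hi0
      exact hik (hunique i k ⟨(hv0 i).lt_of_ne' hi0, by rw [hi, hl]; trivial⟩ hkf (hi.trans hk.symm))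
    · exact ⟨low j, fun h => absurd h hj⟩
  choose top htop using htop
  have hbusyadm : ∀ j, (∃ l, ty j = busy l) →
      v (low j) = 0 ∧ ∑ i with N.station i = j, v i = 1 := by
    rintro j ⟨l, hl⟩
    have hadm := hvQ.2 j
    rw [hl] at hadm
    rw [← hlow j l (Or.inr hl)]
    exact hadm.2
  have hfin := attraction_of_single_service (N := N) (h := h) (c := c) (low := low) (top := top)
    hlowst (hattr _ (isStaticPriority_staticRatio hlowst)) (A := fun j => ∃ l, ty j = busy l)
    hbusy hv0 ?_ ?_ ?_
  · refine hcon (le_trans (le_of_eq ?_) hfin)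
    rw [busyDrift, Finset.sum_filter]
    refine Finset.sum_congr rfl fun k _ => ?_
    by_cases hk : ∃ l, ty (N.station k) = busy l
    · obtain ⟨l, hl⟩ := hk
      rw [← hlow _ l (Or.inr hl), hl]
      by_cases hkl : k = l
      · simp [weight, hkl]
      · simp [weight, hkl]
    · rw [if_neg (fun h => hk h.1), weight_eq_zero (fun l hl => hk ⟨l, hl⟩), zero_mul]
  · intro j hj
    obtain ⟨h1, h2, h3⟩ := htop j hj
    obtain ⟨h4, h5⟩ := hbusyadm j hj
    refine ⟨h1, fun h6 => ?_, ?_, h3⟩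
    · rw [h6, h4] at h2
      exact lt_irrefl _ h2
    · rw [← h5, Finset.sum_eq_single_of_mem (top j) (Finset.mem_filter.2 ⟨Finset.mem_univ _, h1⟩)]
      exact fun k hk hkt => h3 k (Finset.mem_filter.1 hk).2 hkt
  · intro k hk hkl
    have hadm := hvQ.2 (N.station k)
    cases hty : ty (N.station k) with
    | balanced => rw [hty] at hadm; exact hadm.1 k rfl
    | single l =>
      rw [hty] at hadm
      exact hadm.2.1 k rfl (by rw [hlow _ l (Or.inl hty)]; exact hkl)
    | growing => exact absurd (Or.inl hty) (hnot _)
    | draining => exact absurd (Or.inr hty) (hnot _)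
    | busy l => exact absurd ⟨l, hty⟩ hk
  · intro j hj
    have hadm := hvQ.2 j
    cases hty : ty j with
    | balanced => rw [hty] at hadm; exact Or.inr ⟨hadm.1 _ (hlowst j), hadm.2⟩
    | single l => rw [hty] at hadm; exact Or.inl hadm.2.2
    | growing => exact absurd (Or.inl hty) (hnot _)
    | draining => exact absurd (Or.inr hty) (hnot _)
    | busy l => exact absurd ⟨l, hty⟩ hj

end QueueingNetwork

/-! ### Regularity of fluid solutions and the equations at almost every time. -/

namespace QueueingNetwork

variable {J K : ℕ} {N : QueueingNetwork J K}

open MeasureTheory Filter Topology Set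
open scoped NNReal

/-- A function whose integrals over all intervals `[0, t]` vanish is zero almost everywhere on the
positive half-line, if it is nonnegative there. -/
lemma _root_.MeasureTheory.ae_eq_zero_of_forall_intervalIntegral_eq_zero {f : ℝ → ℝ}
    (hf : ∀ᵐ t : ℝ, 0 < t → 0 ≤ f t) (hint : ∀ t, 0 ≤ t → IntervalIntegrable f volume 0 t)
    (hzero : ∀ t, 0 ≤ t → ∫ s in (0 : ℝ)..t, f s = 0) : ∀ᵐ t : ℝ, 0 < t → f t = 0 := by
  have h : ∀ n : ℕ, ∀ᵐ t : ℝ, t ∈ Ioc (0 : ℝ) n → f t = 0 := by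
    intro n
    have hn : (0 : ℝ) ≤ n := Nat.cast_nonneg n
    have h1 := hzero n hn
    rw [intervalIntegral.integral_of_le hn, setIntegral_eq_zero_iff_of_nonneg_ae] at h1
    · exact (ae_restrict_iff' measurableSet_Ioc).1 h1
    · refine (ae_restrict_iff' measurableSet_Ioc).2 ?_
      filter_upwards [hf] with t ht htn using ht htn.1
    · exact (intervalIntegrable_iff_integrableOn_Ioc_of_le hn).1 (hint n hn)
  filter_upwards [ae_all_iff.2 h] with t ht hpos
  obtain ⟨n, hn⟩ := exists_nat_ge t
  exact ht n ⟨hpos, hn⟩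

/-- A Lipschitz function whose derivative is almost everywhere at most `a` grows at most at rate
`a`. -/
lemma _root_.LipschitzOnWith.sub_le_of_ae_deriv_le {f : ℝ → ℝ} {C : ℝ≥0} {a s t : ℝ} (hst : s ≤ t)
    (hf : LipschitzOnWith C f (Icc s t)) (h : ∀ᵐ r : ℝ, r ∈ Ioc s t → deriv f r ≤ a) :
    f t - f s ≤ a * (t - s) := by
  rw [← uIcc_of_le hst] at hf
  have hac := hf.absolutelyContinuousOnInterval
  rw [← hac.integral_deriv_eq_sub]
  have h1 : ∫ r in s..t, deriv f r ≤ ∫ _ in s..t, a := by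
    refine intervalIntegral.integral_mono_ae_restrict hst hac.intervalIntegrable_deriv
      intervalIntegrable_const ?_
    rw [← Measure.restrict_congr_set Ioc_ae_eq_Icc]
    exact (ae_restrict_iff' measurableSet_Ioc).2 h
  rw [intervalIntegral.integral_const, smul_eq_mul, mul_comm] at h1
  exact h1

namespace FluidSolution

variable {Δ : Matrix (Fin K) (Fin J) ℝ} {prio : Equiv.Perm (Fin K)} (X : N.FluidSolution Δ prio)

lemma Z_eq_netFlow {t : ℝ} (ht : 0 ≤ t) :
    X.Z t = X.Z 0 + t • N.α + N.netFlow (X.T t) := by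
  rw [X.Z_eq t ht, netFlow_eq, sub_eq_add_neg]

lemma Y_apply {t : ℝ} (ht : 0 ≤ t) (j : Fin J) :
    X.Y t j = t - ∑ i with N.station i = j, X.T t i := by
  rw [X.Y_eq t ht, Pi.sub_apply, C_mulVec]

lemma W_apply {t : ℝ} (ht : 0 ≤ t) (j : Fin J) :
    X.W t j = ∑ i with N.station i = j, N.m i * X.Z t i := by
  rw [X.W_eq t ht, CM_mulVec]

lemma ε_apply (hΔ : N.IsRatioMatrix Δ) {t : ℝ} (ht : 0 ≤ t) (k : Fin K) :
    X.ε t k = X.Z t k - Δ k (N.station k) * X.W t (N.station k) := by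
  rw [X.ε_eq t ht, Pi.sub_apply, hΔ.mulVec_apply, X.W_apply ht]

/-- Since `Y` is nondecreasing, the allocations of a station together grow by at most the elapsed
time, and each single increment is nonnegative. -/
lemma lipschitzOnWith_T : LipschitzOnWith 1 X.T (Ici 0) := by
  have h : ∀ s t, 0 ≤ s → s ≤ t → ∀ k, |X.T t k - X.T s k| ≤ t - s := by
    intro s t hs hst k
    have ht := hs.trans hst
    have hmono : ∀ i, 0 ≤ X.T t i - X.T s i := fun i => sub_nonneg.2 (X.T_mono i hs ht hst)
    have h1 : X.Y s (N.station k) ≤ X.Y t (N.station k) := X.Y_mono (N.station k) hs ht hst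
    rw [X.Y_apply hs, X.Y_apply ht] at h1
    have h2 := Finset.single_le_sum (s := {i | N.station i = N.station k}) (fun i _ => hmono i)
      (Finset.mem_filter.2 ⟨Finset.mem_univ k, rfl⟩)
    rw [Finset.sum_sub_distrib] at h2
    rw [abs_of_nonneg (hmono k)]
    linarith
  refine LipschitzOnWith.of_dist_le_mul fun s hs t ht => ?_
  rw [NNReal.coe_one, one_mul, dist_pi_le_iff dist_nonneg]
  intro k
  rcases le_total s t with hst | hst
  · rw [dist_comm, dist_comm s, Real.dist_eq, Real.dist_eq, abs_of_nonneg (sub_nonneg.2 hst)]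
    exact h s t hs hst k
  · rw [Real.dist_eq, Real.dist_eq, abs_of_nonneg (sub_nonneg.2 hst)]
    exact h t s ht hst k

lemma exists_lipschitzOnWith_Z : ∃ C, LipschitzOnWith C X.Z (Ici 0) := by
  have h1 : LipschitzWith ‖N.α‖₊ fun t : ℝ => X.Z 0 + t • N.α := by
    refine LipschitzWith.of_dist_le_mul fun s t => ?_
    rw [dist_add_left, dist_eq_norm, ← sub_smul, norm_smul, coe_nnnorm, mul_comm, Real.dist_eq,
      Real.norm_eq_abs]
  have h2 := (LinearMap.toContinuousLinearMap N.netFlow).lipschitz.lipschitzOnWith (s := univ)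
    |>.comp X.lipschitzOnWith_T (mapsTo_univ _ _)
  refine ⟨‖N.α‖₊ + ‖LinearMap.toContinuousLinearMap N.netFlow‖₊ * 1, fun s hs t ht => ?_⟩
  rw [X.Z_eq_netFlow hs, X.Z_eq_netFlow ht]
  exact (h1.lipschitzOnWith (s := Ici 0)).add h2 hs ht

lemma hasDerivAt_Z {t : ℝ} (ht : 0 < t)
    (hd : ∀ k, DifferentiableAt ℝ (fun r => X.T r k) t) (k : Fin K) :
    HasDerivAt (fun r => X.Z r k) (N.drift (fun i => deriv (fun r => X.T r i) t) k) t := by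
  have h1 : HasDerivAt X.T (fun i => deriv (fun r => X.T r i) t) t :=
    hasDerivAt_pi.2 fun i => (hd i).hasDerivAt
  have h2 : HasDerivAt (fun r => N.netFlow (X.T r))
      (N.netFlow fun i => deriv (fun r => X.T r i) t) t :=
    (LinearMap.toContinuousLinearMap N.netFlow).hasFDerivAt.comp_hasDerivAt t h1
  have h3 : HasDerivAt (fun r : ℝ => X.Z 0 + r • N.α) N.α t := by
    simpa using ((hasDerivAt_id t).smul_const N.α).const_add (X.Z 0)
  have h4 := hasDerivAt_pi.1 (h3.add h2) k
  refine h4.congr_of_eventuallyEq ?_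
  filter_upwards [Ioi_mem_nhds ht] with r hr
  rw [X.Z_eq_netFlow (le_of_lt hr)]
  rfl

lemma deriv_Y {t : ℝ} (ht : 0 < t) (hd : ∀ k, DifferentiableAt ℝ (fun r => X.T r k) t)
    (j : Fin J) :
    deriv (fun r => X.Y r j) t = 1 - ∑ i with N.station i = j, deriv (fun r => X.T r i) t := by
  have h1 : HasDerivAt (fun r => ∑ i with N.station i = j, X.T r i)
      (∑ i with N.station i = j, deriv (fun r => X.T r i) t) t :=
    HasDerivAt.fun_sum fun i _ => (hd i).hasDerivAt
  refine (((hasDerivAt_id t).sub h1).congr_of_eventuallyEq ?_).deriv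
  filter_upwards [Ioi_mem_nhds ht] with r hr
  exact X.Y_apply (le_of_lt hr) j

lemma sum_deriv_T_le {t : ℝ} (ht : 0 < t) (hd : ∀ k, DifferentiableAt ℝ (fun r => X.T r k) t)
    (j : Fin J) : ∑ i with N.station i = j, deriv (fun r => X.T r i) t ≤ 1 := by
  have h := deriv_nonneg_of_monotoneOn (X.Y_mono j) ht
  rw [X.deriv_Y ht hd] at h
  linarith

lemma ae_nonidling (j : Fin J) :
    ∀ᵐ t : ℝ, 0 < t → X.W t j * deriv (fun r => X.Y r j) t = 0 := by
  obtain ⟨C, hC⟩ := X.exists_lipschitzOnWith_Z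
  have hW : ContinuousOn (fun t => X.W t j) (Ici 0) := by
    have : ContinuousOn (fun t => ∑ i with N.station i = j, N.m i * X.Z t i) (Ici 0) :=
      continuousOn_finsetSum _ fun i _ => continuousOn_const.mul
        ((continuous_apply i).comp_continuousOn hC.continuousOn)
    exact this.congr fun t ht => X.W_apply ht j
  refine ae_eq_zero_of_forall_intervalIntegral_eq_zero (Eventually.of_forall fun t ht => ?_)
    (fun t ht => ?_) (X.nonidling j)
  · refine mul_nonneg ?_ (deriv_nonneg_of_monotoneOn (X.Y_mono j) ht)
    rw [X.W_apply ht.le]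
    exact Finset.sum_nonneg fun i _ => mul_nonneg (N.m_pos i).le (X.Z_nonneg t ht.le i)
  · have hsub : uIcc 0 t ⊆ Ici 0 := by
      rw [uIcc_of_le ht]; exact Icc_subset_Ici_self
    exact (((X.Y_mono j).mono hsub).intervalIntegrable_deriv).continuousOn_mul (hW.mono hsub)

/-- The integrand is nonnegative, so its vanishing integrals force it to vanish almost everywhere
once it is known to be integrable. The excess is continuous, being a sum of positive parts, and the
service is a sum of integrable derivatives restricted to the relatively closed sets where `0 ≤ ε i`.
-/
lemma ae_priority (hΔ : N.IsRatioMatrix Δ) (k : Fin K) :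
    ∀ᵐ t : ℝ, 0 < t → N.excessUpTo prio (X.ε t) k *
      (1 - N.serviceUpTo prio (X.ε t) (fun i => deriv (fun r => X.T r i) t) k) = 0 := by
  classical
  obtain ⟨C, hC⟩ := X.exists_lipschitzOnWith_Z
  have hZ : ∀ i, ContinuousOn (fun t => X.Z t i) (Ici 0) := fun i =>
    (continuous_apply i).comp_continuousOn hC.continuousOn
  have hε : ∀ i, ContinuousOn (fun t => X.ε t i) (Ici 0) := by
    intro i
    have : ContinuousOn (fun t => X.Z t i - Δ i (N.station i) *
        ∑ l with N.station l = N.station i, N.m l * X.Z t l) (Ici 0) :=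
      (hZ i).sub (continuousOn_const.mul
        (continuousOn_finsetSum _ fun l _ => continuousOn_const.mul (hZ l)))
    exact this.congr fun t ht => by rw [X.ε_apply hΔ ht, X.W_apply ht]
  have hexc : ContinuousOn (fun t => N.excessUpTo prio (X.ε t) k) (Ici 0) := by
    have : ContinuousOn (fun t => ∑ i with N.NotAfter prio i k, max (X.ε t i) 0) (Ici 0) :=
      continuousOn_finsetSum _ fun i _ => (hε i).sup continuousOn_const
    refine this.congr fun t ht => ?_
    unfold excessUpTo
    rw [← Finset.filter_filter, Finset.sum_filter]
    refine Finset.sum_congr rfl fun i _ => ?_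
    split_ifs with h
    · rw [max_eq_left h.le]
    · rw [max_eq_right (not_lt.1 h)]
  refine ae_eq_zero_of_forall_intervalIntegral_eq_zero ?_ (fun t ht => ?_) (X.priority k)
  · filter_upwards [ae_differentiableAt_of_monotoneOn X.T_mono] with t hd ht
    refine mul_nonneg excessUpTo_nonneg (sub_nonneg.2 ?_)
    exact (serviceUpTo_le fun i => deriv_nonneg_of_monotoneOn (X.T_mono i) ht).trans
      (X.sum_deriv_T_le ht (hd ht) _)
  · have hsub : uIcc 0 t ⊆ Ici 0 := by
      rw [uIcc_of_le ht]; exact Icc_subset_Ici_self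
    refine IntervalIntegrable.continuousOn_mul ?_ (hexc.mono hsub)
    refine intervalIntegrable_const.sub ?_
    have hterm : ∀ i, IntervalIntegrable
        (fun s => if 0 ≤ X.ε s i then deriv (fun r => X.T r i) s else 0) volume 0 t := by
      intro i
      have h1 := ((X.T_mono i).mono hsub).intervalIntegrable_deriv
      rw [intervalIntegrable_iff_integrableOn_Icc_of_le ht] at h1 ⊢
      have hclosed : IsClosed (Icc 0 t ∩ (fun s => X.ε s i) ⁻¹' Ici 0) :=
        ((hε i).mono Icc_subset_Ici_self).preimage_isClosed_of_isClosed isClosed_Icc isClosed_Ici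
      refine (h1.indicator hclosed.measurableSet).congr_fun (fun s hs => ?_) measurableSet_Icc
      simp only [indicator, mem_inter_iff, hs, true_and, mem_preimage, mem_Ici]
    have hsum : IntervalIntegrable (∑ i with N.NotAfter prio i k,
        fun s => if 0 ≤ X.ε s i then deriv (fun r => X.T r i) s else 0) volume 0 t :=
      IntervalIntegrable.sum _ fun i _ => hterm i
    refine hsum.congr fun s _ => ?_
    rw [Finset.sum_apply, serviceUpTo, ← Finset.filter_filter,
      Finset.sum_filter (fun i => 0 ≤ X.ε s i)]

end FluidSolution

end QueueingNetwork

/-! ### The potential and its derivative at regular times. -/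

namespace QueueingNetwork

variable {J K : ℕ} {N : QueueingNetwork J K}

open MeasureTheory Filter Topology Set
open scoped NNReal

/-- The largest `w` such that the levels `z` of the classes of station `j` are at least the target
levels for the workload `w`. -/
def minRatio (N : QueueingNetwork J K) (Δ : Matrix (Fin K) (Fin J) ℝ) (z : Fin K → ℝ)
    (j : Fin J) : ℝ :=
  ⨅ k : {k : Fin K // N.station k = j ∧ 0 < Δ k (N.station k)}, z k / Δ k (N.station k)

/-- The weighted total of the levels in excess of the target levels for the workloads `minRatio`. -/
def potential (N : QueueingNetwork J K) (Δ : Matrix (Fin K) (Fin J) ℝ) (h : Fin K → ℝ)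
    (z : Fin K → ℝ) : ℝ :=
  ∑ k, h k * (z k - Δ k (N.station k) * N.minRatio Δ z (N.station k))

section Potential

variable {Δ : Matrix (Fin K) (Fin J) ℝ}

lemma exists_eq_minRatio (hΔ : N.IsRatioMatrix Δ) (z : Fin K → ℝ) (j : Fin J) :
    ∃ k, N.station k = j ∧ 0 < Δ k (N.station k) ∧ z k = Δ k (N.station k) * N.minRatio Δ z j := by
  obtain ⟨k₀, hk₀⟩ := hΔ.exists_pos j
  have : Nonempty {k : Fin K // N.station k = j ∧ 0 < Δ k (N.station k)} := ⟨⟨k₀, hk₀⟩⟩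
  obtain ⟨⟨k, hk⟩, hmin⟩ := exists_eq_ciInf_of_finite
    (f := fun k : {k : Fin K // N.station k = j ∧ 0 < Δ k (N.station k)} =>
      z k / Δ k (N.station k))
  refine ⟨k, hk.1, hk.2, ?_⟩
  rw [minRatio, ← hmin, mul_div_cancel₀ _ hk.2.ne']

lemma mul_minRatio_le (hΔ : N.IsRatioMatrix Δ) {z : Fin K → ℝ} (hz : ∀ k, 0 ≤ z k) (k : Fin K) :
    Δ k (N.station k) * N.minRatio Δ z (N.station k) ≤ z k := by
  rcases (hΔ.nonneg k (N.station k)).eq_or_lt with h | h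
  · rw [← h, zero_mul]; exact hz k
  · rw [← le_div_iff₀' h]
    exact ciInf_le (f := fun l : {l : Fin K // N.station l = N.station k ∧ 0 < Δ l (N.station l)} =>
      z l / Δ l (N.station l)) (Set.finite_range _).bddBelow ⟨k, rfl, h⟩

/-- Compare both states at the class attaining the minimum for one of them. In the constant, classes
with proportion zero contribute nothing because `0⁻¹ = 0`. -/
lemma exists_lipschitz_minRatio (hΔ : N.IsRatioMatrix Δ) (j : Fin J) : ∃ C : ℝ≥0, ∀ z z',
    (∀ k, 0 ≤ z k) → (∀ k, 0 ≤ z' k) →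
      dist (N.minRatio Δ z j) (N.minRatio Δ z' j) ≤ C * dist z z' := by
  have hnn : ∀ k, 0 ≤ (Δ k (N.station k))⁻¹ := fun k => inv_nonneg.2 (hΔ.nonneg k _)
  set L : ℝ := ∑ k, (Δ k (N.station k))⁻¹ with hL
  have hL0 : 0 ≤ L := Finset.sum_nonneg fun k _ => hnn k
  have key : ∀ z z' : Fin K → ℝ, (∀ k, 0 ≤ z k) →
      N.minRatio Δ z j - N.minRatio Δ z' j ≤ L * dist z z' := by
    intro z z' hz
    obtain ⟨k, hk, hpos, heq⟩ := exists_eq_minRatio hΔ z' j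
    have h1 := mul_minRatio_le hΔ hz k
    rw [hk] at h1 hpos heq
    have h2 : z k - z' k ≤ dist z z' :=
      (le_abs_self _).trans ((Real.dist_eq (z k) (z' k)).symm.le.trans (dist_le_pi_dist z z' k))
    have h3 : N.minRatio Δ z j - N.minRatio Δ z' j ≤ (Δ k j)⁻¹ * dist z z' := by
      rw [inv_mul_eq_div, le_div_iff₀' hpos]
      linarith
    refine h3.trans (mul_le_mul_of_nonneg_right ?_ dist_nonneg)
    have h4 := Finset.single_le_sum (fun i _ => hnn i) (Finset.mem_univ k)
    rwa [hk] at h4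
  refine ⟨⟨L, hL0⟩, fun z z' hz hz' => ?_⟩
  rw [Real.dist_eq, abs_le]
  have h1 := key z z' hz
  have h2 := key z' z hz'
  rw [dist_comm] at h2
  change -(L * dist z z') ≤ _ ∧ _ ≤ L * dist z z'
  constructor <;> linarith

lemma potential_nonneg (hΔ : N.IsRatioMatrix Δ) {h : Fin K → ℝ} (hh : ∀ k, 0 < h k)
    {z : Fin K → ℝ} (hz : ∀ k, 0 ≤ z k) : 0 ≤ N.potential Δ h z :=
  Finset.sum_nonneg fun k _ => mul_nonneg (hh k).le (sub_nonneg.2 (mul_minRatio_le hΔ hz k))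

lemma workload_eq_of_proportional (hΔ : N.IsRatioMatrix Δ) {z : Fin K → ℝ} {j : Fin J} {w : ℝ}
    (hz : ∀ k, N.station k = j → z k = Δ k (N.station k) * w) :
    ∑ i with N.station i = j, N.m i * z i = w := by
  rw [← one_mul w, ← hΔ.sum_eq_one j, Finset.sum_mul]
  refine Finset.sum_congr rfl fun i hi => ?_
  rw [hz i (Finset.mem_filter.1 hi).2, mul_assoc]

/-- Every summand is nonnegative with positive weight, so all levels are proportional to `Δ` with
factor `minRatio`; by the normalization this factor is the workload. -/
lemma excess_eq_zero_of_potential_eq_zero (hΔ : N.IsRatioMatrix Δ) {h : Fin K → ℝ}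
    (hh : ∀ k, 0 < h k) {z : Fin K → ℝ} (hz : ∀ k, 0 ≤ z k) (h0 : N.potential Δ h z = 0) :
    z - (Δ * N.C * N.M) *ᵥ z = 0 := by
  have h1 : ∀ k, z k = Δ k (N.station k) * N.minRatio Δ z (N.station k) := by
    intro k
    have h2 := (Finset.sum_eq_zero_iff_of_nonneg fun k _ =>
      mul_nonneg (hh k).le (sub_nonneg.2 (mul_minRatio_le hΔ hz k))).1 h0 k (Finset.mem_univ k)
    exact sub_eq_zero.1 ((mul_eq_zero.1 h2).resolve_left (hh k).ne')
  funext k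
  rw [Pi.sub_apply, hΔ.mulVec_apply, workload_eq_of_proportional hΔ
    (w := N.minRatio Δ z (N.station k)) fun i hi => by rw [← hi]; exact h1 i]
  exact sub_eq_zero.2 (h1 k)

end Potential

namespace FluidSolution

variable {Δ : Matrix (Fin K) (Fin J) ℝ} {prio : Equiv.Perm (Fin K)} (X : N.FluidSolution Δ prio)

lemma exists_lipschitzOnWith_minRatio (hΔ : N.IsRatioMatrix Δ) (j : Fin J) :
    ∃ C, LipschitzOnWith C (fun t => N.minRatio Δ (X.Z t) j) (Ici 0) := by
  obtain ⟨C, hC⟩ := X.exists_lipschitzOnWith_Z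
  obtain ⟨C', hC'⟩ := exists_lipschitz_minRatio hΔ j
  refine ⟨C' * C, LipschitzOnWith.of_dist_le_mul fun s hs t ht => ?_⟩
  refine (hC' _ _ (X.Z_nonneg s hs) (X.Z_nonneg t ht)).trans ?_
  rw [NNReal.coe_mul, mul_assoc]
  exact mul_le_mul_of_nonneg_left (hC.dist_le_mul s hs t ht) C'.2

lemma exists_lipschitzOnWith_potential (hΔ : N.IsRatioMatrix Δ) (h : Fin K → ℝ) :
    ∃ C, LipschitzOnWith C (fun t => N.potential Δ h (X.Z t)) (Ici 0) := by
  obtain ⟨C, hC⟩ := X.exists_lipschitzOnWith_Z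
  have hterm : ∀ k, ∃ C, LipschitzOnWith C (fun t => h k * (X.Z t k - Δ k (N.station k) *
      N.minRatio Δ (X.Z t) (N.station k))) (Ici 0) := by
    intro k
    obtain ⟨D, hD⟩ := X.exists_lipschitzOnWith_minRatio hΔ (N.station k)
    have h1 : LipschitzOnWith C (fun t => X.Z t k) (Ici 0) := fun s hs t ht =>
      (edist_le_pi_edist (X.Z s) (X.Z t) k).trans (hC hs ht)
    have hmul : ∀ a : ℝ, LipschitzWith ‖a‖₊ fun x : ℝ => a * x := fun a => lipschitzWith_smul a
    exact ⟨_, ((hmul (h k)).lipschitzOnWith (s := univ)).comp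
      (h1.sub (((hmul (Δ k (N.station k))).lipschitzOnWith (s := univ)).comp hD
        (mapsTo_univ _ _))) (mapsTo_univ _ _)⟩
  choose D hD using hterm
  refine ⟨∑ k, D k, LipschitzOnWith.of_dist_le_mul fun s hs t ht => ?_⟩
  push_cast
  rw [Finset.sum_mul]
  exact (dist_sum_sum_le _ _ _).trans (Finset.sum_le_sum fun k _ => (hD k).dist_le_mul s hs t ht)

/-- The regular times at which the fluid model equations hold in differential form. -/
structure IsRegular (t : ℝ) : Prop where
  pos : 0 < t
  differentiableAt : ∀ k, DifferentiableAt ℝ (fun r => X.T r k) t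
  differentiableAt_minRatio : ∀ j, DifferentiableAt ℝ (fun r => N.minRatio Δ (X.Z r) j) t
  nonidling : ∀ j, X.W t j * deriv (fun r => X.Y r j) t = 0
  priority : ∀ k, N.excessUpTo prio (X.ε t) k *
      (1 - N.serviceUpTo prio (X.ε t) (fun i => deriv (fun r => X.T r i) t) k) = 0

lemma ae_isRegular (hΔ : N.IsRatioMatrix Δ) : ∀ᵐ t : ℝ, 0 < t → X.IsRegular t := by
  have h1 : ∀ᵐ t : ℝ, ∀ j, 0 < t → DifferentiableAt ℝ (fun r => N.minRatio Δ (X.Z r) j) t := by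
    refine ae_all_iff.2 fun j => ?_
    obtain ⟨C, hC⟩ := X.exists_lipschitzOnWith_minRatio hΔ j
    filter_upwards [hC.ae_differentiableWithinAt_of_mem_real] with t ht hpos
    exact (ht hpos.le).differentiableAt (Ici_mem_nhds hpos)
  filter_upwards [h1, ae_differentiableAt_of_monotoneOn X.T_mono, ae_all_iff.2 X.ae_nonidling,
    ae_all_iff.2 (X.ae_priority hΔ)] with t h1 h2 h3 h4 hpos
  exact ⟨hpos, h2 hpos, fun j => h1 j hpos, fun j => h3 j hpos, fun k => h4 k hpos⟩

namespace IsRegular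

variable {X} {t : ℝ}

/-- If class `k` attains the minimal ratio of its station at `t`, then its drift is the target
proportion of the derivative of the minimal ratio. -/
lemma drift_eq (ht : X.IsRegular t) (hΔ : N.IsRatioMatrix Δ) {k : Fin K}
    (hk : X.Z t k = Δ k (N.station k) * N.minRatio Δ (X.Z t) (N.station k)) :
    N.drift (fun i => deriv (fun r => X.T r i) t) k =
      Δ k (N.station k) * deriv (fun r => N.minRatio Δ (X.Z r) (N.station k)) t := by
  have h1 := (X.hasDerivAt_Z ht.pos ht.differentiableAt k).sub
    ((ht.differentiableAt_minRatio (N.station k)).hasDerivAt.const_mul (Δ k (N.station k)))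
  -- The difference of level and minimal target is never negative and vanishes at `t`, so its
  -- derivative there is zero.
  have h2 : IsLocalMin ((fun r => X.Z r k) - fun r => Δ k (N.station k) *
      N.minRatio Δ (X.Z r) (N.station k)) t := by
    filter_upwards [Ioi_mem_nhds ht.pos] with r hr
    simp only [Pi.sub_apply]
    rw [hk, sub_self]
    exact sub_nonneg.2 (mul_minRatio_le hΔ (X.Z_nonneg r (le_of_lt hr)) k)
  exact sub_eq_zero.1 (h2.hasDerivAt_eq_zero h1)

lemma hasDerivAt_potential (ht : X.IsRegular t) (h : Fin K → ℝ) :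
    HasDerivAt (fun r => N.potential Δ h (X.Z r))
      (∑ k, h k * (N.drift (fun i => deriv (fun r => X.T r i) t) k - Δ k (N.station k) *
        deriv (fun r => N.minRatio Δ (X.Z r) (N.station k)) t)) t :=
  HasDerivAt.fun_sum fun k _ => ((X.hasDerivAt_Z ht.pos ht.differentiableAt k).sub
    ((ht.differentiableAt_minRatio (N.station k)).hasDerivAt.const_mul
      (Δ k (N.station k)))).const_mul (h k)

open StationType in
/-- At a regular time the allocation rates of a station whose classes are not at their target levels
are those of a busy station, and the minimal ratio does not decrease. -/
lemma exists_busy (ht : X.IsRegular t) (hΔ : N.IsRatioMatrix Δ) {j : Fin J} {k₀ : Fin K}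
    (hk₀ : N.station k₀ = j) (hne : X.ε t k₀ ≠ 0) :
    ∃ l, (busy l).Admits N (fun i => deriv (fun r => X.T r i) t) j ∧
      X.Z t l = Δ l (N.station l) * N.minRatio Δ (X.Z t) (N.station l) ∧
      0 ≤ deriv (fun r => N.minRatio Δ (X.Z r) j) t := by
  have ht0 := ht.pos.le
  have hv : ∀ i, 0 ≤ deriv (fun r => X.T r i) t := fun i =>
    deriv_nonneg_of_monotoneOn (X.T_mono i) ht.pos
  -- The excesses, weighted by service times, cancel by the normalization of `Δ`. So one class off
  -- target yields a class `p` above and a class `q` below.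
  have hsum : ∑ i with N.station i = j, N.m i * X.ε t i = 0 := by
    have h1 : ∑ i with N.station i = j, N.m i * X.ε t i
        = ∑ i with N.station i = j, N.m i * X.Z t i
          - (∑ i with N.station i = j, N.m i * Δ i (N.station i)) * X.W t j := by
      rw [Finset.sum_mul, ← Finset.sum_sub_distrib]
      refine Finset.sum_congr rfl fun i hi => ?_
      rw [X.ε_apply hΔ ht0, (Finset.mem_filter.1 hi).2]
      ring
    rw [h1, hΔ.sum_eq_one, X.W_apply ht0, one_mul, sub_self]
  have hk₀mem : k₀ ∈ Finset.univ.filter fun i => N.station i = j :=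
    Finset.mem_filter.2 ⟨Finset.mem_univ _, hk₀⟩
  have hne' : N.m k₀ * X.ε t k₀ ≠ 0 := mul_ne_zero (N.m_pos k₀).ne' hne
  obtain ⟨p, hp, hp0⟩ := Finset.exists_pos_of_sum_zero_of_exists_nonzero _ hsum ⟨k₀, hk₀mem, hne'⟩
  obtain ⟨q, hq, hq0⟩ := Finset.exists_pos_of_sum_zero_of_exists_nonzero
    (fun i => -(N.m i * X.ε t i)) (by rw [Finset.sum_neg_distrib, hsum, neg_zero])
    ⟨k₀, hk₀mem, neg_ne_zero.2 hne'⟩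
  replace hp := (Finset.mem_filter.1 hp).2
  replace hq := (Finset.mem_filter.1 hq).2
  replace hp0 : 0 < X.ε t p := pos_of_mul_pos_right hp0 (N.m_pos p).le
  replace hq0 : X.ε t q < 0 := by
    by_contra! hcon
    have := mul_nonneg (N.m_pos q).le hcon
    linarith
  rw [X.ε_apply hΔ ht0, hq] at hq0
  -- Because `q` is below target, the minimal ratio is less than the workload, which puts the
  -- minimizing class `l` below target as well.
  have hlt : N.minRatio Δ (X.Z t) j < X.W t j := by
    have h1 := mul_minRatio_le hΔ (X.Z_nonneg t ht0) q
    rw [hq] at h1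
    exact lt_of_mul_lt_mul_left (by linarith) (hΔ.nonneg q j)
  obtain ⟨l, hl, hlpos, hleq⟩ := exists_eq_minRatio hΔ (X.Z t) j
  have hlε : X.ε t l < 0 := by
    rw [X.ε_apply hΔ ht0, hleq, hl]
    rw [hl] at hlpos
    nlinarith
  -- As `p` is above target, the station spends all its effort on classes not below target, which
  -- excludes `l`.
  have hserv : N.serviceUpTo prio (X.ε t) (fun i => deriv (fun r => X.T r i) t) p = 1 := by
    have h1 := (mul_eq_zero.1 (ht.priority p)).resolve_left
      (excessUpTo_pos_iff.2 ⟨p, ⟨rfl, le_rfl⟩, hp0⟩).ne'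
    linarith
  have hle := X.sum_deriv_T_le ht.pos ht.differentiableAt j
  have h2 := serviceUpTo_le (N := N) (prio := prio) (ε := X.ε t) (k := p) hv
  have h3 := serviceUpTo_add_le (N := N) (prio := prio) (ε := X.ε t) (k := p) hv
    (hl.trans hp.symm) hlε
  rw [hserv, hp] at h2 h3
  have hl0 : deriv (fun r => X.T r l) t = 0 := le_antisymm (by linarith) (hv l)
  have hleq' : X.Z t l = Δ l (N.station l) * N.minRatio Δ (X.Z t) (N.station l) := by
    rw [hleq, hl]
  refine ⟨l, ⟨hl, hl0, le_antisymm hle h2⟩, hleq', ?_⟩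
  have h4 := drift_nonneg_of_eq_zero N hv hl0
  rw [ht.drift_eq hΔ hleq', hl] at h4
  rw [hl] at hlpos
  exact nonneg_of_mul_nonneg_right h4 hlpos

open StationType in
/-- At a regular time the allocation rates of a station whose classes are all at their target levels
satisfy the constraints of a type other than `busy`. -/
lemma exists_admits (ht : X.IsRegular t) (hΔ : N.IsRatioMatrix Δ) {j : Fin J}
    (hε : ∀ k, N.station k = j → X.ε t k = 0) :
    (∃ ty : StationType K, ty.Admits N (fun i => deriv (fun r => X.T r i) t) j ∧
      ∀ l, ty ≠ busy l) ∧
    ∀ k, N.station k = j →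
      X.Z t k = Δ k (N.station k) * N.minRatio Δ (X.Z t) (N.station k) := by
  have ht0 := ht.pos.le
  have hZ : ∀ k, N.station k = j → X.Z t k = Δ k (N.station k) * X.W t j := by
    intro k hk
    have h1 := hε k hk
    rw [X.ε_apply hΔ ht0] at h1
    rw [sub_eq_zero.1 h1, hk]
  obtain ⟨l, hl, hlpos, hleq⟩ := exists_eq_minRatio hΔ (X.Z t) j
  have hmin : N.minRatio Δ (X.Z t) j = X.W t j :=
    mul_left_cancel₀ hlpos.ne' (hleq.symm.trans (hZ l hl))
  have hZ' : ∀ k, N.station k = j →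
      X.Z t k = Δ k (N.station k) * N.minRatio Δ (X.Z t) (N.station k) := by
    intro k hk
    rw [hk, hmin, ← hk, hZ k hk, hk]
  refine ⟨?_, hZ'⟩
  have hdrift : ∀ k, N.station k = j → N.drift (fun i => deriv (fun r => X.T r i) t) k =
      Δ k j * deriv (fun r => N.minRatio Δ (X.Z r) j) t := by
    intro k hk
    rw [ht.drift_eq hΔ (hZ' k hk), hk]
  -- An empty station has all its levels at a minimum, so their drifts vanish. A nonempty one is
  -- saturated, and its drifts are nonnegative multiples of one common derivative.
  rcases eq_or_ne (X.W t j) 0 with hW | hW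
  · refine ⟨balanced, ⟨fun k hk => ?_, X.sum_deriv_T_le ht.pos ht.differentiableAt j⟩, nofun⟩
    have h1 : IsLocalMin (fun r => X.Z r k) t := by
      filter_upwards [Ioi_mem_nhds ht.pos] with r hr
      rw [hZ k hk, hW, mul_zero]
      exact X.Z_nonneg r (le_of_lt hr) k
    exact h1.hasDerivAt_eq_zero (X.hasDerivAt_Z ht.pos ht.differentiableAt k)
  · have hsum : ∑ i with N.station i = j, deriv (fun r => X.T r i) t = 1 := by
      have h1 := (mul_eq_zero.1 (ht.nonidling j)).resolve_left hW
      rw [X.deriv_Y ht.pos ht.differentiableAt] at h1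
      linarith
    rcases le_total 0 (deriv (fun r => N.minRatio Δ (X.Z r) j) t) with h1 | h1
    · refine ⟨growing, ⟨fun k hk => ?_, hsum⟩, nofun⟩
      rw [hdrift k hk]
      exact mul_nonneg (hΔ.nonneg k j) h1
    · refine ⟨draining, ⟨fun k hk => ?_, hsum⟩, nofun⟩
      rw [hdrift k hk]
      exact mul_nonpos_of_nonneg_of_nonpos (hΔ.nonneg k j) h1

open StationType in
/-- The potential decreases at least at rate `c` as long as some class is not at its target level. -/
theorem deriv_potential_le (ht : X.IsRegular t) (hΔ : N.IsRatioMatrix Δ) {h : Fin K → ℝ} {c : ℝ}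
    (hh : ∀ k, 0 < h k)
    (hattr : ∀ Δ : Matrix (Fin K) (Fin J) ℝ, N.IsStaticPriority Δ → N.LinearAttraction Δ h c)
    (hne : X.ε t ≠ 0) : deriv (fun r => N.potential Δ h (X.Z r)) t ≤ -c := by
  set v : Fin K → ℝ := fun i => deriv (fun r => X.T r i) t with hv
  -- Termwise domination by the weighted drift: the minimizing class contributes zero, and for the
  -- others the subtracted derivative of the minimal ratio is nonnegative and can be dropped.
  have htype : ∀ j, ∃ ty : StationType K, ty.Admits N v j ∧
      ((∃ k, N.station k = j ∧ X.ε t k ≠ 0) → ∃ l, ty = busy l) ∧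
      ∀ k, N.station k = j → h k * (N.drift v k - Δ k (N.station k) *
        deriv (fun r => N.minRatio Δ (X.Z r) (N.station k)) t) ≤ ty.weight h k * N.drift v k := by
    intro j
    by_cases hj : ∃ k, N.station k = j ∧ X.ε t k ≠ 0
    · obtain ⟨k₀, hk₀, hk₀ne⟩ := hj
      obtain ⟨l, hadm, hl, hnonneg⟩ := ht.exists_busy hΔ hk₀ hk₀ne
      refine ⟨busy l, hadm, fun _ => ⟨l, rfl⟩, fun k hk => ?_⟩
      by_cases hkl : k = l
      · rw [hkl, hv, ht.drift_eq hΔ hl, sub_self, mul_zero]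
        simp [weight]
      · simp only [weight, hkl, if_false]
        refine mul_le_mul_of_nonneg_left (sub_le_self _ ?_) (hh k).le
        rw [hk]
        exact mul_nonneg (hΔ.nonneg k j) hnonneg
    · push Not at hj
      obtain ⟨⟨ty, hty, hnb⟩, hZ⟩ := ht.exists_admits hΔ hj
      refine ⟨ty, hty, fun ⟨k, hk, hk0⟩ => absurd (hj k hk) hk0, fun k hk => ?_⟩
      rw [hv, ht.drift_eq hΔ (hZ k hk), sub_self, mul_zero, weight_eq_zero hnb, zero_mul]
  choose ty hadm hbusy hle using htype
  have h1 := busyDrift_le hh hattr (fun j => (hΔ.exists_pos j).imp fun _ hk => hk.1) ty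
    (by
      obtain ⟨k, hk⟩ := Function.ne_iff.1 hne
      exact ⟨N.station k, hbusy _ ⟨k, rfl, hk⟩⟩)
    (u := v) ⟨fun i => deriv_nonneg_of_monotoneOn (X.T_mono i) ht.pos, hadm⟩
  rw [(ht.hasDerivAt_potential h).deriv]
  exact (Finset.sum_le_sum fun k _ => hle (N.station k) k rfl).trans h1

/-- The potential does not move while all classes are at their target levels. -/
lemma deriv_potential_eq_zero (ht : X.IsRegular t) (hΔ : N.IsRatioMatrix Δ) (h : Fin K → ℝ)
    (hε : X.ε t = 0) : deriv (fun r => N.potential Δ h (X.Z r)) t = 0 := by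
  rw [(ht.hasDerivAt_potential h).deriv]
  refine Finset.sum_eq_zero fun k _ => ?_
  rw [ht.drift_eq hΔ ((ht.exists_admits hΔ (j := N.station k) fun k _ => congrFun hε k).2 k rfl),
    sub_self, mul_zero]

end IsRegular

end FluidSolution

end QueueingNetwork

/-! ### Extinction of the potential in finite time. -/

namespace QueueingNetwork

variable {J K : ℕ} {N : QueueingNetwork J K}

open MeasureTheory Set

/-- Under linear attraction for the static-priority policies, the potential of a fluid solution of a
queue-ratio policy vanishes from time `potential / c` on. -/
theorem FluidSolution.potential_eq_zero {Δ : Matrix (Fin K) (Fin J) ℝ} {prio : Equiv.Perm (Fin K)}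
    (X : N.FluidSolution Δ prio) (hΔ : N.IsRatioMatrix Δ) {h : Fin K → ℝ} {c : ℝ}
    (hh : ∀ k, 0 < h k) (hc : 0 < c)
    (hattr : ∀ Δ : Matrix (Fin K) (Fin J) ℝ, N.IsStaticPriority Δ → N.LinearAttraction Δ h c)
    {t : ℝ} (ht : N.potential Δ h (X.Z 0) / c ≤ t) : N.potential Δ h (X.Z t) = 0 := by
  have hnonneg : ∀ s, 0 ≤ s → 0 ≤ N.potential Δ h (X.Z s) := fun s hs =>
    potential_nonneg hΔ hh (X.Z_nonneg s hs)
  have ht0 : 0 ≤ t := (div_nonneg (hnonneg 0 le_rfl) hc.le).trans ht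
  obtain ⟨C, hC⟩ := X.exists_lipschitzOnWith_potential hΔ h
  have hmono : ∀ s, 0 ≤ s → s ≤ t → N.potential Δ h (X.Z t) ≤ N.potential Δ h (X.Z s) := by
    intro s hs hst
    have hC' : LipschitzOnWith C _ (Icc s t) := hC.mono fun r hr => hs.trans hr.1
    have h1 := hC'.sub_le_of_ae_deriv_le (a := 0) hst (by
        filter_upwards [X.ae_isRegular hΔ] with r hr hrs
        have hreg := hr (hs.trans_lt hrs.1)
        by_cases hε : X.ε r = 0
        · exact (hreg.deriv_potential_eq_zero hΔ h hε).le
        · exact (hreg.deriv_potential_le hΔ hh hattr hε).trans (neg_nonpos.2 hc.le))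
    linarith
  by_contra hne
  have hpos : 0 < N.potential Δ h (X.Z t) := (hnonneg t ht0).lt_of_ne' hne
  -- A potential that is positive at `t` is, by monotonicity, positive on all of `(0, t]`. So some
  -- class is off target throughout, and the decrease at rate `c` would have used up the initial
  -- value by time `t`.
  have h1 := (hC.mono fun r hr => hr.1 : LipschitzOnWith C _ (Icc 0 t)).sub_le_of_ae_deriv_le
    (a := -c) ht0 (by
      filter_upwards [X.ae_isRegular hΔ] with r hr hrs
      have hreg := hr hrs.1
      refine hreg.deriv_potential_le hΔ hh hattr fun hε => ?_
      have h2 := hmono r hrs.1.le hrs.2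
      have h3 : N.potential Δ h (X.Z r) = 0 := Finset.sum_eq_zero fun k _ => by
        rw [← (hreg.exists_admits hΔ (j := N.station k) fun k _ => congrFun hε k).2 k rfl, sub_self,
          mul_zero]
      linarith)
  rw [div_le_iff₀ hc] at ht
  linarith

end QueueingNetwork

end

theorem mainTheorem3 {J K : ℕ} (N : QueueingNetwork J K) (h : Fin K → ℝ) (c : ℝ)
    (hh : ∀ k, 0 < h k) (hc : 0 < c)
    (hattr : ∀ Δ : Matrix (Fin K) (Fin J) ℝ, N.IsStaticPriority Δ → N.LinearAttraction Δ h c)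
    (Δ : Matrix (Fin K) (Fin J) ℝ) (hΔ : N.IsRatioMatrix Δ) (prio : Equiv.Perm (Fin K))
    (z₀ : Fin K → ℝ) (hz₀ : ∀ k, 0 ≤ z₀ k) :
    ∃ t₀ : ℝ, 0 ≤ t₀ ∧ ∀ X : N.FluidSolution Δ prio, X.Z 0 = z₀ →
      ∀ t, t₀ ≤ t → X.ε t = 0 ∧ X.Z t - (Δ * N.C * N.M) *ᵥ X.Z t = 0 := by
  refine ⟨N.potential Δ h z₀ / c,
    div_nonneg (QueueingNetwork.potential_nonneg hΔ hh hz₀) hc.le, fun X hX t ht => ?_⟩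
  have ht0 : 0 ≤ t :=
    (div_nonneg (QueueingNetwork.potential_nonneg hΔ hh hz₀) hc.le).trans ht
  rw [← hX] at ht
  have h1 := QueueingNetwork.excess_eq_zero_of_potential_eq_zero hΔ hh (X.Z_nonneg t ht0)
    (X.potential_eq_zero hΔ hh hc hattr ht)
  exact ⟨(X.ε_eq t ht0).trans h1, h1⟩
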